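/- \textbf{Lemma 6 (Normal Variation Lemma for Codimension 2 and Higher).} Let $0 \le k < d$ and let $\Sigma \subset \mathbb{R}^d$ be a compact (closed and bounded) smooth embedded $k$-manifold without boundary. For $p \in \Sigma$ let $T_p\Sigma$ be the tangent $k$-flat through $p$ and $N_p\Sigma$ the orthogonal $(d-k)$-flat through $p$. Let the medial axis $M$ be the closure of the set of centers of all open balls that are disjoint from $\Sigma$ and whose boundary meets $\Sigma$ in more than one point, and let $\mathrm{lfs}(p)$ be the distance from $p$ to $M$ ($\infty$ if $M = \emptyset$). For flats $F, G$ with $\dim F \le \dim G$ let $\angle(F,G) = \angle(G,F) = \max_{\ell_F \subset F} \min_{\ell_G \subset G} \angle(\ell_F,\ell_G)$ over lines $\ell_F,\ell_G$, an angle in $[0,\pi/2]$ ($0$ if $F$ is a point). Let $p, q \in \Sigma$, let $\delta = |pq|/\mathrm{lfs}(p)$, and let $\delta_N$ be the distance from $q$ to $T_p\Sigma$ divided by $\mathrm{lfs}(p)$. If $\delta < \sqrt{(\sqrt5-1)/2} \approx 0.7861$, then $$\angle(N_p\Sigma, N_q\Sigma) = \angle(T_p\Sigma, T_q\Sigma)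 \le \eta_2(\delta) = \arccos\sqrt{1 - \frac{\delta^2}{\sqrt{1-\delta^2}}},$$ where, as $\delta \to 0^+$, $\eta_2(\delta) = \delta + \frac{5}{12}\delta^3 + \frac{57}{160}\delta^5 + \frac{327}{896}\delta^7 + O(\delta^9)$. Moreover, $$\angle(N_p\Sigma, N_q\Sigma) \le \arccos\sqrt{\left(1 - \frac{\delta^2}{2\sqrt{1-\delta^2}}\right)^2 - \frac{\delta_N^2}{1-\delta^2}},$$ and the right-hand side is at most $\eta_2(\delta)$. If $q \in T_p\Sigma$ (that is, $\delta_N = 0$), this right-hand side equals $\eta_1(\delta) = \arccos\left(1 - \frac{\delta^2}{2\sqrt{1-\delta^2}}\right)$. -/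

import Mathlib

open scoped ContDiff

noncomputable section

/-- `S` is a smooth (embedded) `k`-dimensional submanifold without boundary of `ℝᵈ`: around each of
its points there are smooth coordinates of `ℝᵈ` (a diffeomorphism between open sets) in which `S`
is the coordinate subspace where all coordinates but the first `k` vanish. -/
def IsSmoothSubmanifold {d : ℕ} (k : ℕ) (S : Set (EuclideanSpace ℝ (Fin d))) : Prop :=
  ∀ p ∈ S, ∃ Φ : OpenPartialHomeomorph (EuclideanSpace ℝ (Fin d)) (EuclideanSpace ℝ (Fin d)),
    p ∈ Φ.source ∧ ContDiffOn ℝ ∞ Φ Φ.source ∧ ContDiffOn ℝ ∞ Φ.symm Φ.target ∧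
      ∀ x ∈ Φ.source, (x ∈ S ↔ ∀ i : Fin d, k ≤ (i : ℕ) → Φ x i = 0)

/-- The linear space of directions tangent to `S` at `p`: the span of the velocities at `p` of
curves in `S` (for a submanifold, these velocities already form a linear subspace). -/
def tangentDirections {d : ℕ} (S : Set (EuclideanSpace ℝ (Fin d)))
    (p : EuclideanSpace ℝ (Fin d)) : Submodule ℝ (EuclideanSpace ℝ (Fin d)) :=
  Submodule.span ℝ {v | ∃ γ : ℝ → EuclideanSpace ℝ (Fin d),
    γ 0 = p ∧ (∀ᶠ t in nhds 0, γ t ∈ S) ∧ HasDerivAt γ v 0}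

/-- The tangent space `T_p S`, a flat through `p`. -/
def tangentFlat {d : ℕ} (S : Set (EuclideanSpace ℝ (Fin d)))
    (p : EuclideanSpace ℝ (Fin d)) : AffineSubspace ℝ (EuclideanSpace ℝ (Fin d)) :=
  AffineSubspace.mk' p (tangentDirections S p)

/-- The normal space `N_p S`, the flat through `p` that is completely orthogonal to `T_p S`. -/
def normalFlat {d : ℕ} (S : Set (EuclideanSpace ℝ (Fin d)))
    (p : EuclideanSpace ℝ (Fin d)) : AffineSubspace ℝ (EuclideanSpace ℝ (Fin d)) :=
  AffineSubspace.mk' p (tangentDirections S p)ᗮ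

/-- The angle, in `[0, π/2]`, between two (undirected) lines with direction vectors `u`, `v`. -/
def lineAngle {d : ℕ} (u v : EuclideanSpace ℝ (Fin d)) : ℝ :=
  min (InnerProductGeometry.angle u v) (InnerProductGeometry.angle u (-v))

/-- `max` over the lines of `F` of the `min` over the lines of `G` of the angle between the lines;
it is `0` if `F` is a point, so contains no line. -/
def maxMinAngle {d : ℕ} (F G : AffineSubspace ℝ (EuclideanSpace ℝ (Fin d))) : ℝ :=
  sSup {θ | ∃ u ∈ F.direction, u ≠ 0 ∧
    θ = sInf {φ | ∃ v ∈ G.direction, v ≠ 0 ∧ φ = lineAngle u v}}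

open Classical in
/-- The angle separating two flats: the maximum is over the lines of the flat of smaller dimension,
the minimum over the lines of the flat of larger dimension. -/
def flatAngle {d : ℕ} (F G : AffineSubspace ℝ (EuclideanSpace ℝ (Fin d))) : ℝ :=
  if Module.finrank ℝ F.direction ≤ Module.finrank ℝ G.direction then maxMinAngle F G
  else maxMinAngle G F

/-- The medial axis of `S`: the closure of the set of centers of the open balls that do not meet
`S` but whose boundary meets `S` in more than one point. -/
def medialAxis {d : ℕ} (S : Set (EuclideanSpace ℝ (Fin d))) :
    Set (EuclideanSpace ℝ (Fin d)) :=
  closure {w | ∃ r : ℝ, 0 < r ∧ Disjoint (Metric.ball w r) S ∧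
    (Metric.sphere w r ∩ S).Nontrivial}

/-- The local feature size: the distance from `p` to the medial axis (`∞` if the medial axis is
empty, as for a set that consists of one point). -/
def localFeatureSize {d : ℕ} (S : Set (EuclideanSpace ℝ (Fin d)))
    (p : EuclideanSpace ℝ (Fin d)) : ENNReal :=
  Metric.infEDist p (medialAxis S)

/-- `δ = |pq| / lfs(p)`. -/
def relDist {d : ℕ} (S : Set (EuclideanSpace ℝ (Fin d)))
    (p q : EuclideanSpace ℝ (Fin d)) : ENNReal :=
  edist p q / localFeatureSize S p

/-- `δ_N`, the distance from `q` to the tangent space `T_p S`, divided by `lfs(p)`. -/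
def relNormalDist {d : ℕ} (S : Set (EuclideanSpace ℝ (Fin d)))
    (p q : EuclideanSpace ℝ (Fin d)) : ENNReal :=
  Metric.infEDist q (tangentFlat S p : Set (EuclideanSpace ℝ (Fin d))) / localFeatureSize S p

/-- The bound `η₁` for codimension one. -/
def eta₁ (δ : ℝ) : ℝ :=
  Real.arccos (1 - δ ^ 2 / (2 * √(1 - δ ^ 2)))

/-- The bound `η₂` for general codimension. -/
def eta₂ (δ : ℝ) : ℝ :=
  Real.arccos √(1 - δ ^ 2 / √(1 - δ ^ 2))

/-- The bound for general codimension that takes the normal component `δ_N` into account. -/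
def etaNormal (δ δN : ℝ) : ℝ :=
  Real.arccos √((1 - δ ^ 2 / (2 * √(1 - δ ^ 2))) ^ 2 - δN ^ 2 / (1 - δ ^ 2))

end

/-! Move p to the origin and scale lfs(p) to 1, so that the open unit ball misses the medial axis. A
small ball touching the surface at a point a of the unit ball is empty by smoothness, and it stays
empty while it is inflated along its normal as long as its center remains in the unit ball: off the
medial axis nearest points are unique, and there the distance function can grow at unit rate
(`ball_disjoint_of_disjoint_medialAxis`). Only this emptiness and the local openness of projections
to the tangent space at 0 are used afterwards, and `IsNormalizedSurface` records exactly these.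

Empty unit balls tangent at 0 give 2δ_N ≤ δ². A continuation argument (`exists_lift`) shows that the
surface has a point over every t in the tangent space with |t|² ≤ 1/2.

Let m be a unit normal at a = q, and let c = a + s m lie on the unit sphere, with normal part
(relative to the tangent space at 0) of length b. Let n be a unit vector along this normal part.
Over the tangential part of the point nearest to c on the unit sphere about -n there is a surface
point, and it is at most |c + n| - 1 = √(2 + 2b) - 1 away from c. Emptiness of the ball about c
bounds s by this number, that is, b ≥ (s² + 2s - 1)/2 (`le_norm_normal_center`).

Apply this to both m and -m, with radii s and r. Then s r = 1 - δ² = σ² (power of a point). A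
weighted sum of the two squared normal parts eliminates the cross term, and the worst case is s = r
= σ. The result bounds the normal part of m from below by the stated expression
(`normal_variation`), and 2δ_N ≤ δ² weakens it to η₂. Linear algebra turns projection bounds into
angles and identifies tangent and normal angles. The expansion of η₂ is obtained by integrating that
of its derivative. -/

/-! ### Taylor expansion of η₂ at 0. -/

open Filter Asymptotics Topology in
/-- If `u² - b² = O(l)` and `u + b` stays away from `0`, then `u - b = O(l)`. -/
theorem isBigO_sub_of_sq_sub_sq {u b l : ℝ → ℝ} {F : Filter ℝ}
    (h : (fun z => u z ^ 2 - b z ^ 2) =O[F] l) (hb : ∀ᶠ z in F, 1 / 2 ≤ u z + b z) :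
    (fun z => u z - b z) =O[F] l := by
  refine IsBigO.trans (IsBigO.of_bound 2 ?_) h
  filter_upwards [hb] with z hz
  rw [sq_sub_sq, norm_mul, Real.norm_eq_abs, Real.norm_eq_abs, abs_of_nonneg (by linarith : 0 ≤ u z + b z)]
  nlinarith [abs_nonneg (u z - b z)]

open Filter Asymptotics Topology in
theorem isBigO_pow_mul_of_continuous {f : ℝ → ℝ} (hf : Continuous f) (n : ℕ) :
    (fun z : ℝ => z ^ n * f z) =O[𝓝 0] fun z => z ^ n := by
  simpa using (isBigO_refl (fun z : ℝ => z ^ n) (𝓝 0)).mul ((hf.tendsto 0).isBigO_one ℝ)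

-- With z = δ² this is the derivative of η₂. Each square root is compared with its Taylor polynomial
-- by squaring, which leaves polynomial identities; the denominator is cleared last, being bounded
-- away from 0.
open Filter Asymptotics Topology in
theorem eta₂_deriv_expansion :
    (fun z : ℝ => (2 - z) / (2 * (1 - z) * √(√(1 - z) - z)) -
      (1 + 5 / 4 * z + 57 / 32 * z ^ 2 + 327 / 128 * z ^ 3)) =O[𝓝 0] fun z => z ^ 4 := by
  have c1 : Tendsto (fun z : ℝ => √(1 - z)) (𝓝 0) (𝓝 1) := by
    have : Continuous fun z : ℝ => √(1 - z) := by fun_prop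
    simpa using this.tendsto 0
  have zs : ∀ᶠ z : ℝ in 𝓝 0, |z| < 1 / 4 := by
    have := (continuous_abs.tendsto (0 : ℝ)).eventually_lt_const (u := 1 / 4) (by norm_num)
    exact this
  have e1 : (fun z : ℝ => √(1 - z) - (1 - z / 2 - z ^ 2 / 8 - z ^ 3 / 16)) =O[𝓝 0]
      fun z => z ^ 4 := by
    refine isBigO_sub_of_sq_sub_sq
      (((isBigO_pow_mul_of_continuous (f := fun z => -(5 / 64 + z / 64 + z ^ 2 / 256))
        (by fun_prop) 4)).congr' ?_ .rfl) ?_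
    · filter_upwards [zs] with z hz
      rw [abs_lt] at hz
      rw [Real.sq_sqrt (by linarith)]
      ring
    · have : Continuous fun z : ℝ => √(1 - z) + (1 - z / 2 - z ^ 2 / 8 - z ^ 3 / 16) := by fun_prop
      exact (this.tendsto 0).eventually_const_le (by norm_num)
  have e2 : (fun z : ℝ => √(√(1 - z) - z) - (1 - 3 / 4 * z - 11 / 32 * z ^ 2 - 37 / 128 * z ^ 3))
      =O[𝓝 0] fun z => z ^ 4 := by
    -- The outer root inherits the error `e1` of the inner one; the quadratic in z is what remains
    -- of the polynomial part after extracting z⁴.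
    refine isBigO_sub_of_sq_sub_sq (((isBigO_pow_mul_of_continuous
      (f := fun z => -(565/1024 + 407/2048 * z + 1369/16384 * z ^ 2))
        (by fun_prop) 4)).add e1 |>.congr' ?_ .rfl) ?_
    · filter_upwards [c1.eventually_const_le (u := 1 / 2) (by norm_num), zs] with z hz hz'
      rw [abs_lt] at hz'
      rw [Real.sq_sqrt (by linarith)]
      ring
    · have : Continuous fun z : ℝ =>
        √(√(1 - z) - z) + (1 - 3 / 4 * z - 11 / 32 * z ^ 2 - 37 / 128 * z ^ 3) := by fun_prop
      exact (this.tendsto 0).eventually_const_le (by norm_num)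
  have e3 : (fun z : ℝ => (2 - z) - 2 * (1 - z) * √(√(1 - z) - z) *
      (1 + 5 / 4 * z + 57 / 32 * z ^ 2 + 327 / 128 * z ^ 3)) =O[𝓝 0] fun z => z ^ 4 := by
    have hc : Continuous fun z : ℝ => 2 * (1 - z) *
      (1 + 5 / 4 * z + 57 / 32 * z ^ 2 + 327 / 128 * z ^ 3) := by fun_prop
    have := e2.mul ((hc.tendsto 0).isBigO_one ℝ)
    simp only [mul_one] at this
    refine (isBigO_pow_mul_of_continuous 
      (f := fun z => 3471 / 512 - 3065 / 1024 * z - 10725 / 8192 * z ^ 2 - 12099 / 8192 * z ^ 3)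
      (by fun_prop) 4).sub this |>.congr_left fun z => ?_
    ring
  have : ∀ᶠ z in 𝓝 (0 : ℝ), 1 / 2 ≤ 2 * (1 - z) * √(√(1 - z) - z) := by
    have : Continuous fun z : ℝ => 2 * (1 - z) * √(√(1 - z) - z) := by fun_prop
    exact (this.tendsto 0).eventually_const_le (by norm_num)
  refine IsBigO.trans (IsBigO.of_bound 2 ?_) e3
  filter_upwards [this] with z hz
  have hpos : 0 < 2 * (1 - z) * √(√(1 - z) - z) := by linarith
  have : (2 - z) / (2 * (1 - z) * √(√(1 - z) - z)) -
      (1 + 5 / 4 * z + 57 / 32 * z ^ 2 + 327 / 128 * z ^ 3) = ((2 - z) - 2 * (1 - z) * √(√(1 - z) - z) *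
      (1 + 5 / 4 * z + 57 / 32 * z ^ 2 + 327 / 128 * z ^ 3)) / (2 * (1 - z) * √(√(1 - z) - z)) := by
    rw [sub_div (2 - z), mul_div_cancel_left₀ _ hpos.ne']
  rw [this, norm_div, Real.norm_of_nonneg hpos.le, div_le_iff₀ hpos]
  nlinarith [norm_nonneg ((2 - z) - 2 * (1 - z) * √(√(1 - z) - z) *
      (1 + 5 / 4 * z + 57 / 32 * z ^ 2 + 327 / 128 * z ^ 3))]

theorem hasDerivAt_eta₂ {δ : ℝ} (h0 : 0 < δ) (h1 : δ < 1 / 2) :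
    HasDerivAt eta₂ ((2 - δ ^ 2) / (2 * (1 - δ ^ 2) * √(√(1 - δ ^ 2) - δ ^ 2))) δ := by
  have hz : 0 < 1 - δ ^ 2 := by nlinarith
  have hu : 0 < √(1 - δ ^ 2) := Real.sqrt_pos.2 hz
  have hu2 : √(1 - δ ^ 2) ^ 2 = 1 - δ ^ 2 := Real.sq_sqrt hz.le
  have hlt : δ ^ 2 < √(1 - δ ^ 2) := by
    apply Real.lt_sqrt_of_sq_lt
    nlinarith
  have hx : 0 < 1 - δ ^ 2 / √(1 - δ ^ 2) := by
    rw [sub_pos, div_lt_one hu]; exact hlt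
  have hx' : 0 < δ ^ 2 / √(1 - δ ^ 2) := by positivity
  have hw : 0 < √(1 - δ ^ 2 / √(1 - δ ^ 2)) := Real.sqrt_pos.2 hx
  have hw2 := Real.sq_sqrt hx.le
  have hw1 : √(1 - δ ^ 2 / √(1 - δ ^ 2)) < 1 := by nlinarith
  have d1 : HasDerivAt (fun δ : ℝ => 1 - δ ^ 2) (-(2 * δ)) δ := by
    simpa using ((hasDerivAt_pow 2 δ).const_sub 1)
  have d2 := d1.sqrt hz.ne'
  have d3 : HasDerivAt (fun δ : ℝ => 1 - δ ^ 2 / √(1 - δ ^ 2)) _ δ :=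
    ((hasDerivAt_pow 2 δ).div d2 hu.ne').const_sub 1
  have d4 := d3.sqrt hx.ne'
  have d5 : HasDerivAt eta₂ _ δ :=
    (Real.hasDerivAt_arccos (by linarith) hw1.ne).comp δ d4
  convert d5 using 1
  have hv : √(1 - √(1 - δ ^ 2 / √(1 - δ ^ 2)) ^ 2) = δ / √(√(1 - δ ^ 2)) := by
    rw [hw2, sub_sub_cancel, Real.sqrt_div (sq_nonneg δ), Real.sqrt_sq h0.le]
  have hw' : √(1 - δ ^ 2 / √(1 - δ ^ 2)) = √(√(1 - δ ^ 2) - δ ^ 2) / √(√(1 - δ ^ 2)) := by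
    rw [← Real.sqrt_div (by linarith)]
    congr 1
    field_simp
  rw [hv, hw']
  have ha : 0 < √(√(1 - δ ^ 2)) := Real.sqrt_pos.2 hu
  have hb : 0 < √(√(1 - δ ^ 2) - δ ^ 2) := Real.sqrt_pos.2 (by linarith)
  have ha2 : √(√(1 - δ ^ 2)) ^ 2 = √(1 - δ ^ 2) := Real.sq_sqrt hu.le
  generalize √(√(1 - δ ^ 2) - δ ^ 2) = b at *
  generalize √(√(1 - δ ^ 2)) = a at *
  generalize √(1 - δ ^ 2) = u at *
  subst ha2
  rw [← hu2]
  field_simp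
  linear_combination (-2 * δ) * hu2

theorem continuousOn_eta₂ : ContinuousOn eta₂ (Set.Icc 0 (1 / 2)) := by
  have : ∀ δ ∈ Set.Icc (0 : ℝ) (1 / 2), √(1 - δ ^ 2) ≠ 0 := by
    rintro δ ⟨h0, h1⟩
    exact (Real.sqrt_pos.2 (by nlinarith)).ne'
  unfold eta₂
  fun_prop (disch := assumption)

theorem eta₂_zero : eta₂ 0 = 0 := by simp [eta₂]

-- The error vanishes at 0 and its derivative is O(δ⁸), so the mean value theorem gives O(δ⁹). Only
-- right-sided differentiability is available, η₂ being even.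
open Filter Asymptotics Topology in
theorem eta₂_expansion :
    (fun δ : ℝ => eta₂ δ - (δ + 5 / 12 * δ ^ 3 + 57 / 160 * δ ^ 5 + 327 / 896 * δ ^ 7))
      =O[nhdsWithin 0 (Set.Ioi 0)] (fun δ : ℝ => δ ^ 9) := by
  obtain ⟨C, hC⟩ := eta₂_deriv_expansion.bound
  obtain ⟨ε, hε, hball⟩ := Metric.eventually_nhds_iff.1 hC
  refine IsBigO.of_bound C ?_
  have h1 : ∀ᶠ δ : ℝ in 𝓝[>] 0, δ < min (1 / 2) ε :=
    nhdsWithin_le_nhds (gt_mem_nhds (by positivity))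
  filter_upwards [h1, self_mem_nhdsWithin] with δ hδ hδ0
  rw [lt_min_iff] at hδ
  rw [Set.mem_Ioi] at hδ0
  obtain ⟨c, ⟨hc0, hcδ⟩, hc⟩ := exists_hasDerivAt_eq_slope
    (fun δ : ℝ => eta₂ δ - (δ + 5 / 12 * δ ^ 3 + 57 / 160 * δ ^ 5 + 327 / 896 * δ ^ 7))
    (fun δ => (2 - δ ^ 2) / (2 * (1 - δ ^ 2) * √(√(1 - δ ^ 2) - δ ^ 2)) -
      (1 + 5 / 4 * δ ^ 2 + 57 / 32 * (δ ^ 2) ^ 2 + 327 / 128 * (δ ^ 2) ^ 3)) hδ0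
    ((continuousOn_eta₂.mono (Set.Icc_subset_Icc le_rfl hδ.1.le)).sub (by fun_prop))
    (by
      rintro x ⟨hx0, hx1⟩
      refine (hasDerivAt_eta₂ hx0 (hx1.trans hδ.1)).sub ?_
      have e := (((hasDerivAt_id x).add ((hasDerivAt_pow 3 x).const_mul (5 / 12))).add
        ((hasDerivAt_pow 5 x).const_mul (57 / 160))).add ((hasDerivAt_pow 7 x).const_mul (327 / 896))
      refine e.congr_deriv ?_
      norm_num
      ring)
  have hb := hball (y := c ^ 2) (by
    rw [Real.dist_eq, sub_zero, abs_of_nonneg (by positivity)]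
    nlinarith)
  rw [hc] at hb
  simp only [eta₂_zero] at hb
  norm_num at hb
  rw [abs_of_pos hδ0, div_le_iff₀ hδ0] at hb
  rw [Real.norm_eq_abs, Real.norm_eq_abs, abs_of_pos (by positivity : 0 < δ ^ 9)]
  refine hb.trans ?_
  -- The constant from `IsBigO.bound` carries no sign, and monotonicity in c needs one.
  have hC0 : 0 ≤ C := by
    by_contra! hneg
    have := hb.trans_lt (mul_neg_of_neg_of_pos (mul_neg_of_neg_of_pos hneg (by positivity)) hδ0)
    exact absurd this (not_lt.2 (abs_nonneg _))
  have : (c ^ 2) ^ 4 ≤ δ ^ 8 := by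
    rw [← pow_mul]; exact pow_le_pow_left₀ hc0.le hcδ.le _
  calc C * (c ^ 2) ^ 4 * δ ≤ C * δ ^ 8 * δ := by gcongr
    _ = C * δ ^ 9 := by ring

/-! ### Angles between flats as bounds on orthogonal projections. -/

section Angles

variable {d : ℕ}

theorem lineAngle_eq_arccos (u v : EuclideanSpace ℝ (Fin d)) :
    lineAngle u v = Real.arccos (|inner ℝ u v| / (‖u‖ * ‖v‖)) := by
  have h : ∀ x : ℝ, min (Real.arccos x) (Real.arccos (-x)) = Real.arccos |x| := by
    intro x
    rcases le_total 0 x with hx | hx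
    · rw [abs_of_nonneg hx, min_eq_left (Real.arccos_le_arccos (by linarith))]
    · rw [abs_of_nonpos hx, min_eq_right (Real.arccos_le_arccos (by linarith))]
  unfold lineAngle InnerProductGeometry.angle
  rw [inner_neg_right, norm_neg, neg_div, h, abs_div, abs_of_nonneg (by positivity : 0 ≤ ‖u‖ * ‖v‖)]

/-- The closest line of G is spanned by the projection of u; if the projection vanishes, every line
of G is at angle π/2. -/
theorem sInf_lineAngle {G : Submodule ℝ (EuclideanSpace ℝ (Fin d))} (hG : G ≠ ⊥)
    {u : EuclideanSpace ℝ (Fin d)} (hu : u ≠ 0) :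
    sInf {φ | ∃ v ∈ G, v ≠ 0 ∧ φ = lineAngle u v} =
      Real.arccos (‖G.starProjection u‖ / ‖u‖) := by
  have hu' : 0 < ‖u‖ := norm_pos_iff.2 hu
  have hinner : ∀ v ∈ G, inner ℝ u v = inner ℝ (G.starProjection u) v := by
    intro v hv
    rw [G.inner_starProjection_left_eq_right, G.starProjection_eq_self_iff.2 hv]
  apply IsLeast.csInf_eq
  constructor
  · by_cases hp : G.starProjection u = 0
    · obtain ⟨v, hv, hv0⟩ := G.exists_mem_ne_zero_of_ne_bot hG
      refine ⟨v, hv, hv0, ?_⟩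
      rw [lineAngle_eq_arccos, hinner v hv, hp]
      simp
    · refine ⟨_, G.starProjection_apply_mem u, hp, ?_⟩
      have hp' : 0 < ‖G.starProjection u‖ := norm_pos_iff.2 hp
      rw [lineAngle_eq_arccos, hinner _ (G.starProjection_apply_mem u),
        real_inner_self_eq_norm_sq, abs_of_nonneg (sq_nonneg _)]
      congr 1
      field_simp
  · rintro _ ⟨v, hv, hv0, rfl⟩
    have hv' : 0 < ‖v‖ := norm_pos_iff.2 hv0
    rw [lineAngle_eq_arccos, hinner v hv]
    apply Real.arccos_le_arccos
    rw [div_le_div_iff₀ (by positivity) hu']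
    nlinarith [abs_real_inner_le_norm (G.starProjection u) v]

/-- Equal dimension ensures that G contains a line as soon as F does; otherwise the inner infimum
would be the junk value of `sInf ∅`. -/
theorem maxMinAngle_le_iff {F G : AffineSubspace ℝ (EuclideanSpace ℝ (Fin d))}
    (h : Module.finrank ℝ F.direction = Module.finrank ℝ G.direction) {θ : ℝ} (h0 : 0 ≤ θ)
    (h1 : θ ≤ Real.pi / 2) :
    maxMinAngle F G ≤ θ ↔
      ∀ u ∈ F.direction, Real.cos θ * ‖u‖ ≤ ‖G.direction.starProjection u‖ := by
  have hpi := Real.pi_pos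
  have key : ∀ u ∈ F.direction, u ≠ 0 →
      sInf {φ | ∃ v ∈ G.direction, v ≠ 0 ∧ φ = lineAngle u v} =
        Real.arccos (‖G.direction.starProjection u‖ / ‖u‖) := by
    intro u hu hu0
    refine sInf_lineAngle ?_ hu0
    intro hb
    rw [hb, finrank_bot] at h
    rw [Submodule.finrank_eq_zero.1 h] at hu
    exact hu0 ((Submodule.mem_bot ℝ).1 hu)
  have hle : ∀ u ∈ F.direction, u ≠ 0 →
      (sInf {φ | ∃ v ∈ G.direction, v ≠ 0 ∧ φ = lineAngle u v} ≤ θ ↔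
        Real.cos θ * ‖u‖ ≤ ‖G.direction.starProjection u‖) := by
    intro u hu hu0
    have hu' : 0 < ‖u‖ := norm_pos_iff.2 hu0
    have h01 : ‖G.direction.starProjection u‖ / ‖u‖ ≤ 1 :=
      div_le_one_of_le₀ (G.direction.norm_starProjection_apply_le u) hu'.le
    have h00 : 0 ≤ ‖G.direction.starProjection u‖ / ‖u‖ := by positivity
    rw [key u hu hu0, ← le_div_iff₀ hu']
    conv_lhs => rw [← Real.arccos_cos h0 (by linarith)]
    exact Real.strictAntiOn_arccos.le_iff_ge (Set.mem_Icc.2 ⟨by linarith, h01⟩)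
      (Set.mem_Icc.2 ⟨Real.neg_one_le_cos θ, Real.cos_le_one θ⟩)
  constructor
  · intro hm u hu
    by_cases hu0 : u = 0
    · simp [hu0]
    have hbdd : BddAbove {θ | ∃ u ∈ F.direction, u ≠ 0 ∧
        θ = sInf {φ | ∃ v ∈ G.direction, v ≠ 0 ∧ φ = lineAngle u v}} := by
      refine ⟨Real.pi, ?_⟩
      rintro _ ⟨w, hw, hw0, rfl⟩
      rw [key w hw hw0]
      exact Real.arccos_le_pi _
    exact (hle u hu hu0).1 ((le_csSup hbdd ⟨u, hu, hu0, rfl⟩).trans hm)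
  · intro hm
    refine Real.sSup_le ?_ h0
    rintro _ ⟨w, hw, hw0, rfl⟩
    exact (hle w hw hw0).2 (hm w hw)

theorem maxMinAngle_mem_Icc {F G : AffineSubspace ℝ (EuclideanSpace ℝ (Fin d))}
    (h : Module.finrank ℝ F.direction = Module.finrank ℝ G.direction) :
    maxMinAngle F G ∈ Set.Icc 0 (Real.pi / 2) := by
  constructor
  · refine Real.sSup_nonneg ?_
    rintro _ ⟨u, -, -, rfl⟩
    refine Real.sInf_nonneg ?_
    rintro _ ⟨v, -, -, rfl⟩
    rw [lineAngle_eq_arccos]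
    exact Real.arccos_nonneg _
  · rw [maxMinAngle_le_iff h (by positivity) le_rfl]
    intro u _
    simp

variable {E : Type*} [NormedAddCommGroup E] [InnerProductSpace ℝ E] [FiniteDimensional ℝ E]

/-- For subspaces of equal dimension, a lower bound on the lengths of the projections of one to
the other is symmetric. -/
theorem mul_norm_le_norm_starProjection_symm {F G : Submodule ℝ E}
    (h : Module.finrank ℝ F = Module.finrank ℝ G) {c : ℝ}
    (hc : ∀ u ∈ F, c * ‖u‖ ≤ ‖G.starProjection u‖) :
    ∀ v ∈ G, c * ‖v‖ ≤ ‖F.starProjection v‖ := by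
  intro v hv
  rcases le_or_gt c 0 with hc0 | hc0
  · exact (mul_nonpos_of_nonpos_of_nonneg hc0 (norm_nonneg v)).trans (norm_nonneg _)
  -- As c > 0, the projection from F to G is injective, hence onto by dimension. Write v as the
  -- projection of u; pairing u with the projection of v to F gives ‖v‖², and ‖u‖ ≤ ‖v‖ / c.
  have hinj : Function.Injective (G.orthogonalProjectionOnto.toLinearMap ∘ₗ F.subtype) := by
    rw [← LinearMap.ker_eq_bot, LinearMap.ker_eq_bot']
    rintro ⟨u, hu⟩ h0
    have h1 := hc u hu
    rw [Submodule.starProjection_apply] at h1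
    simp only [LinearMap.coe_comp, Function.comp_apply, Submodule.subtype_apply,
      ContinuousLinearMap.coe_coe] at h0
    rw [h0] at h1
    have : ‖u‖ ≤ 0 := by
      simp only [ZeroMemClass.coe_zero, norm_zero] at h1
      by_contra! hn
      nlinarith [mul_pos hc0 hn]
    exact Subtype.ext (norm_le_zero_iff.1 this)
  obtain ⟨⟨u, hu⟩, huv⟩ := (LinearMap.injective_iff_surjective_of_finrank_eq_finrank h).1 hinj ⟨v, hv⟩
  have huv' : G.starProjection u = v := by
    rw [Submodule.starProjection_apply]
    exact congrArg Subtype.val huv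
  by_cases hv0 : v = 0
  · simp [hv0]
  have hvn : 0 < ‖v‖ := norm_pos_iff.2 hv0
  have hun : 0 < ‖u‖ := by
    rw [norm_pos_iff]
    rintro rfl
    exact hv0 (by rw [← huv', map_zero])
  have h1 : inner ℝ (F.starProjection v) u = ‖v‖ ^ 2 := by
    rw [F.inner_starProjection_left_eq_right, F.starProjection_eq_self_iff.2 hu,
      ← real_inner_self_eq_norm_sq]
    nth_rw 3 [← huv']
    rw [← G.inner_starProjection_left_eq_right, G.starProjection_eq_self_iff.2 hv]
  have h2 := real_inner_le_norm (F.starProjection v) u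
  have h3 := hc u hu
  rw [huv'] at h3
  rw [h1] at h2
  by_contra! hlt
  nlinarith [mul_lt_mul_of_pos_right hlt hun, mul_le_mul_of_nonneg_left h3 hvn.le]

/-- The bound `‖P_H u‖ ≤ b ‖u‖` on `F` is equivalent to the same bound for `P_F` on `H`. -/
theorem norm_starProjection_le_symm {F H : Submodule ℝ E} {b : ℝ} (hb : 0 ≤ b)
    (h : ∀ u ∈ F, ‖H.starProjection u‖ ≤ b * ‖u‖) :
    ∀ v ∈ H, ‖F.starProjection v‖ ≤ b * ‖v‖ := by
  intro v hv
  have h1 : inner ℝ (F.starProjection v) (F.starProjection v) =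
      inner ℝ v (H.starProjection (F.starProjection v)) := by
    rw [← H.inner_starProjection_left_eq_right, H.starProjection_eq_self_iff.2 hv,
      F.inner_starProjection_left_eq_right, F.starProjection_eq_self_iff.2 (F.starProjection_apply_mem v)]
  rw [real_inner_self_eq_norm_sq] at h1
  have h2 := real_inner_le_norm v (H.starProjection (F.starProjection v))
  have h3 := h _ (F.starProjection_apply_mem v)
  by_contra! hlt
  have h4 : 0 < ‖F.starProjection v‖ := lt_of_le_of_lt (by positivity) hlt
  nlinarith [mul_lt_mul_of_pos_right hlt h4, mul_le_mul_of_nonneg_left h3 (norm_nonneg v)]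

theorem cos_mul_norm_le_iff {G : Submodule ℝ E} {θ : ℝ} (h0 : 0 ≤ θ) (h1 : θ ≤ Real.pi / 2) (u : E) :
    Real.cos θ * ‖u‖ ≤ ‖G.starProjection u‖ ↔ ‖Gᗮ.starProjection u‖ ≤ Real.sin θ * ‖u‖ := by
  have hpi := Real.pi_pos
  have hs := Real.sin_nonneg_of_nonneg_of_le_pi h0 (by linarith)
  have hc := Real.cos_nonneg_of_neg_pi_div_two_le_of_le (by linarith) h1
  have e := Submodule.norm_sq_eq_add_norm_sq_starProjection u G
  have e' := Real.sin_sq_add_cos_sq θ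
  rw [← sq_le_sq₀ (by positivity) (norm_nonneg (G.starProjection u)),
    ← sq_le_sq₀ (norm_nonneg _) (by positivity)]
  have e'' : (Real.sin θ * ‖u‖) ^ 2 + (Real.cos θ * ‖u‖) ^ 2 = ‖u‖ ^ 2 := by
    linear_combination ‖u‖ ^ 2 * e'
  constructor <;> intro h <;> linarith

/-- Reverse the roles of F and G, pass by Pythagoras to a sine bound for the projection of G to Fᗮ,
take adjoints, and pass back by Pythagoras. -/
theorem cos_mul_norm_le_orthogonal {F G : Submodule ℝ E} {θ : ℝ} (h0 : 0 ≤ θ)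
    (h1 : θ ≤ Real.pi / 2) (h : Module.finrank ℝ F = Module.finrank ℝ G)
    (hF : ∀ u ∈ F, Real.cos θ * ‖u‖ ≤ ‖G.starProjection u‖) :
    ∀ u ∈ Fᗮ, Real.cos θ * ‖u‖ ≤ ‖Gᗮ.starProjection u‖ := by
  have hs := Real.sin_nonneg_of_nonneg_of_le_pi h0 (by linarith [Real.pi_pos])
  have h2 := mul_norm_le_norm_starProjection_symm h hF
  have h3 : ∀ u ∈ G, ‖Fᗮ.starProjection u‖ ≤ Real.sin θ * ‖u‖ :=
    fun u hu => (cos_mul_norm_le_iff h0 h1 u).1 (h2 u hu)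
  intro u hu
  rw [cos_mul_norm_le_iff h0 h1]
  simp only [Submodule.orthogonal_orthogonal]
  exact norm_starProjection_le_symm hs h3 u hu

/-- Flats of equal dimension and their orthogonal complements are separated by the same angle. -/
theorem maxMinAngle_orthogonal (p q : EuclideanSpace ℝ (Fin d))
    {F G : Submodule ℝ (EuclideanSpace ℝ (Fin d))}
    (h : Module.finrank ℝ F = Module.finrank ℝ G) :
    maxMinAngle (AffineSubspace.mk' p Fᗮ) (AffineSubspace.mk' q Gᗮ) =
      maxMinAngle (AffineSubspace.mk' p F) (AffineSubspace.mk' q G) := by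
  have h' : Module.finrank ℝ Fᗮ = Module.finrank ℝ Gᗮ := by
    have h1 := F.finrank_add_finrank_orthogonal
    have h2 := G.finrank_add_finrank_orthogonal
    omega
  have hd : Module.finrank ℝ (AffineSubspace.mk' p F).direction =
      Module.finrank ℝ (AffineSubspace.mk' q G).direction := by
    rwa [AffineSubspace.direction_mk', AffineSubspace.direction_mk']
  have hd' : Module.finrank ℝ (AffineSubspace.mk' p Fᗮ).direction =
      Module.finrank ℝ (AffineSubspace.mk' q Gᗮ).direction := by
    rwa [AffineSubspace.direction_mk', AffineSubspace.direction_mk']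
  have hm : maxMinAngle (AffineSubspace.mk' p F) (AffineSubspace.mk' q G) ∈ Set.Icc 0 (Real.pi / 2) :=
    maxMinAngle_mem_Icc hd
  have hm' : maxMinAngle (AffineSubspace.mk' p Fᗮ) (AffineSubspace.mk' q Gᗮ) ∈
      Set.Icc 0 (Real.pi / 2) := maxMinAngle_mem_Icc hd'
  apply le_antisymm
  · rw [maxMinAngle_le_iff hd' hm.1 hm.2]
    have := (maxMinAngle_le_iff hd hm.1 hm.2).1 le_rfl
    simp only [AffineSubspace.direction_mk'] at this ⊢
    exact cos_mul_norm_le_orthogonal hm.1 hm.2 h this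
  · rw [maxMinAngle_le_iff hd hm'.1 hm'.2]
    have := (maxMinAngle_le_iff hd' hm'.1 hm'.2).1 le_rfl
    simp only [AffineSubspace.direction_mk'] at this ⊢
    have := cos_mul_norm_le_orthogonal hm'.1 hm'.2 h' this
    simpa only [Submodule.orthogonal_orthogonal] using this

end Angles

/-! ### Growth of the distance function and inflation of empty balls. -/

section Distance

variable {E : Type*} [NormedAddCommGroup E] [InnerProductSpace ℝ E]

open Metric Set in
/-- Off a compact set, the distance function has slope at least `1` at a point whose nearest point
is unique. -/
theorem exists_infDist_lt_of_unique_nearest {S : Set E} (hS : IsCompact S) (hne : S.Nonempty)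
    {y : E} (hy : 0 < infDist y S)
    (huniq : ∀ a ∈ S, ∀ b ∈ S, dist y a = infDist y S → dist y b = infDist y S → a = b)
    {c ε : ℝ} (hc0 : 0 ≤ c) (hc : c < 1) (hε : 0 < ε) :
    ∃ z, dist z y < ε ∧ infDist y S + c * dist z y < infDist z S := by
  obtain ⟨a, ha, hda⟩ := hS.exists_infDist_eq_dist hne y
  set D := infDist y S with hD
  have hnorm : ‖y - a‖ = D := by rw [← dist_eq_norm, hda]
  set u := D⁻¹ • (y - a) with hu
  have hun : ‖u‖ = 1 := by
    rw [hu, norm_smul, hnorm, norm_inv, Real.norm_of_nonneg hy.le, inv_mul_cancel₀ hy.ne']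
  have hua : inner ℝ u (y - a) = D := by
    rw [hu, real_inner_smul_left, real_inner_self_eq_norm_sq, hnorm]
    field_simp
  -- K collects the points from which a step along u retreats too slowly. It misses the unique
  -- nearest point, so by compactness it is farther than D by a margin η, and a step of length at
  -- most η/4 cannot bring the nearest point into K.
  set K := S ∩ {b | inner ℝ u (y - b) ≤ c * D} with hK
  have hKc : IsCompact K := hS.inter_right (isClosed_le (by fun_prop) continuous_const)
  obtain ⟨η, hη, hηK⟩ : ∃ η > 0, ∀ b ∈ K, D + η ≤ dist y b := by
    rcases K.eq_empty_or_nonempty with hKe | hKn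
    · exact ⟨1, one_pos, by simp [hKe]⟩
    obtain ⟨b, hb, hdb⟩ := hKc.exists_infDist_eq_dist hKn y
    refine ⟨dist y b - D, ?_, ?_⟩
    · have h1 : D ≤ dist y b := infDist_le_dist_of_mem hb.1
      rcases h1.lt_or_eq with h2 | h2
      · linarith
      · exfalso
        have hab := huniq a ha b hb.1 hda.symm h2.symm
        have h3 : inner ℝ u (y - b) ≤ c * D := hb.2
        rw [← hab, hua] at h3
        nlinarith
    · intro b' hb'
      have := infDist_le_dist_of_mem (x := y) hb'
      linarith
  set h := min (ε / 2) (η / 4) with hh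
  have hh0 : 0 < h := by positivity
  have hz : dist (y + h • u) y = h := by
    rw [dist_eq_norm, add_sub_cancel_left, norm_smul, hun, Real.norm_of_nonneg hh0.le, mul_one]
  refine ⟨y + h • u, ?_, ?_⟩
  · rw [hz]; linarith [min_le_left (ε / 2) (η / 4)]
  obtain ⟨b, hb, hdb⟩ := hS.exists_infDist_eq_dist hne (y + h • u)
  have h1 : infDist (y + h • u) S ≤ D + h := by
    linarith [infDist_le_infDist_add_dist (s := S) (x := y + h • u) (y := y)]
  have hbK : b ∉ K := by
    intro hbK
    have h2 := hηK b hbK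
    have h3 := dist_triangle_left y b (y + h • u)
    rw [hz, ← hdb] at h3
    linarith [min_le_right (ε / 2) (η / 4)]
  have hin : c * D < inner ℝ u (y - b) := by
    by_contra! hcon
    exact hbK ⟨hb, hcon⟩
  have hyb : D ≤ ‖y - b‖ := by
    rw [← dist_eq_norm]; exact infDist_le_dist_of_mem hb
  have hsq : ‖y + h • u - b‖ ^ 2 = ‖y - b‖ ^ 2 + 2 * h * inner ℝ u (y - b) + h ^ 2 := by
    rw [show y + h • u - b = (y - b) + h • u by abel, norm_add_sq_real, norm_smul, hun,
      real_inner_smul_right, real_inner_comm, mul_one, Real.norm_eq_abs, sq_abs]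
    ring
  rw [hz, hdb, dist_eq_norm]
  apply lt_of_pow_lt_pow_left₀ 2 (norm_nonneg _)
  rw [hsq]
  have hc2 : (c * h) ^ 2 ≤ h ^ 2 := by
    apply pow_le_pow_left₀ (by positivity)
    nlinarith
  nlinarith [mul_lt_mul_of_pos_left hin hh0]

variable [FiniteDimensional ℝ E]

open Metric Set in
/-- If nearest points are unique on a ball, then the distance function reaches the largest value
that the radius of the ball allows. -/
theorem exists_dist_eq_infDist_eq_add {S : Set E} (hS : IsCompact S) (hne : S.Nonempty)
    {x : E} (hx : 0 < infDist x S) {s : ℝ} (hs : 0 ≤ s)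
    (huniq : ∀ y ∈ closedBall x s, 0 < infDist y S → ∀ a ∈ S, ∀ b ∈ S,
      dist y a = infDist y S → dist y b = infDist y S → a = b) :
    ∃ y, dist y x = s ∧ infDist x S + s ≤ infDist y S := by
  have : ProperSpace E := FiniteDimensional.proper ℝ E
  have key : ∀ c : ℝ, 0 ≤ c → c < 1 → ∃ y ∈ sphere x s, infDist x S + c * s ≤ infDist y S := by
    intro c hc0 hc
    -- This replaces a gradient flow: an interior maximizer of the penalized distance could be
    -- improved by a step of slope above c, so the maximizer lies on the sphere. Then c tends to 1.
    obtain ⟨y, hy, hmax⟩ := (isCompact_closedBall x s).exists_isMaxOn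
      ⟨x, mem_closedBall_self hs⟩
      (f := fun y => infDist y S - c * dist y x) (by
        have := continuous_infDist_pt S
        fun_prop)
    have hmax' : ∀ z ∈ closedBall x s, infDist z S - c * dist z x ≤ infDist y S - c * dist y x :=
      fun z hz => hmax hz
    have h1 := hmax' x (mem_closedBall_self hs)
    rw [dist_self, mul_zero, sub_zero] at h1
    rcases (mem_closedBall.1 hy).lt_or_eq with hlt | heq
    · exfalso
      have hpos : 0 < infDist y S := by
        have : 0 ≤ c * dist y x := by positivity
        linarith
      obtain ⟨z, hz, hz'⟩ := exists_infDist_lt_of_unique_nearest hS hne hpos (huniq y hy hpos)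
        hc0 hc (sub_pos.2 hlt)
      have h2 := dist_triangle z y x
      have h3 := hmax' z (mem_closedBall.2 (by linarith))
      nlinarith [mul_le_mul_of_nonneg_left h2 hc0]
    · refine ⟨y, mem_sphere.2 heq, ?_⟩
      rw [heq] at h1
      linarith
  obtain ⟨y0, hy0, -⟩ := key 0 le_rfl one_pos
  obtain ⟨y, hy, hmax⟩ := (isCompact_sphere x s).exists_isMaxOn ⟨y0, hy0⟩
    (f := fun y => infDist y S) (continuous_infDist_pt S).continuousOn
  refine ⟨y, mem_sphere.1 hy, ?_⟩
  have hlim : ∀ c : ℝ, 0 ≤ c → c < 1 → infDist x S + c * s ≤ infDist y S := by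
    intro c hc0 hc
    obtain ⟨z, hz, hz'⟩ := key c hc0 hc
    exact hz'.trans (hmax hz)
  by_contra! hcon
  have hs' : 0 < s := by
    by_contra! h0
    have hs0 : s = 0 := le_antisymm h0 hs
    have := hlim 0 le_rfl one_pos
    rw [hs0] at hcon
    linarith
  have hlt : max 0 ((infDist y S - infDist x S) / s) < 1 := by
    rw [max_lt_iff, div_lt_one hs']
    exact ⟨one_pos, by linarith⟩
  obtain ⟨c, hc, hc1⟩ := exists_between hlt
  rw [max_lt_iff, div_lt_iff₀ hs'] at hc
  have := hlim c hc.1.le hc1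
  linarith

open Metric Set in
/-- If the ball that touches `S` at `q` with center `q + t • m` does not meet `S`, then it can be
inflated as long as nearest points remain unique. -/
theorem ball_extend {S : Set E} (hS : IsCompact S) {q m : E} (hq : q ∈ S) (hm : ‖m‖ = 1)
    {t s : ℝ} (ht : 0 < t) (hs : 0 ≤ s) (hball : ∀ a ∈ S, t ≤ dist (q + t • m) a)
    (huniq : ∀ y ∈ closedBall (q + t • m) s, 0 < infDist y S → ∀ a ∈ S, ∀ b ∈ S,
      dist y a = infDist y S → dist y b = infDist y S → a = b) :
    ∀ a ∈ S, t + s ≤ dist (q + (t + s) • m) a := by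
  have hne : S.Nonempty := ⟨q, hq⟩
  have hd : t ≤ infDist (q + t • m) S := (le_infDist hne).2 hball
  obtain ⟨y, hy, hyd⟩ := exists_dist_eq_infDist_eq_add hS hne (ht.trans_le hd) hs huniq
  have h1 : infDist y S ≤ dist y q := infDist_le_dist_of_mem hq
  have hyx : ‖y - (q + t • m)‖ = s := by rw [← dist_eq_norm, hy]
  have hsum : ‖(y - (q + t • m)) + t • m‖ = ‖y - q‖ := by congr 1; abel
  have htm : ‖t • m‖ = t := by rw [norm_smul, hm, Real.norm_of_nonneg ht.le, mul_one]
  have hge : t + s ≤ ‖y - q‖ := by rw [← dist_eq_norm]; linarith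
  -- Equality in the triangle inequality: y is s away from the old center, which is t away from q,
  -- yet y is at least t + s from q.
  have hye : y = q + (t + s) • m := by
    have hsq := norm_add_sq_real (y - (q + t • m)) (t • m)
    rw [hsum, hyx, htm, real_inner_smul_right] at hsq
    have hin : s ≤ inner ℝ (y - (q + t • m)) m := by
      by_contra! hcon
      nlinarith [mul_lt_mul_of_pos_left hcon ht]
    have h0 : ‖(y - (q + t • m)) - s • m‖ ^ 2 ≤ 0 := by
      rw [norm_sub_sq_real, hyx, norm_smul, hm, real_inner_smul_right, Real.norm_of_nonneg hs]
      nlinarith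
    have h0' : (y - (q + t • m)) - s • m = 0 := by
      rw [← norm_eq_zero]
      exact pow_eq_zero_iff two_ne_zero |>.1 (le_antisymm h0 (sq_nonneg _))
    rw [add_smul, ← sub_eq_zero, ← h0']
    abel
  intro a ha
  rw [← hye]
  linarith [infDist_le_dist_of_mem (x := y) ha]

variable {d : ℕ}

open Metric Set in
theorem nearest_unique_of_notMem_medialAxis {S : Set (EuclideanSpace ℝ (Fin d))}
    {y : EuclideanSpace ℝ (Fin d)} (hy : y ∉ medialAxis S) (hpos : 0 < infDist y S) :
    ∀ a ∈ S, ∀ b ∈ S, dist y a = infDist y S → dist y b = infDist y S → a = b := by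
  intro a ha b hb hda hdb
  by_contra hab
  refine hy (subset_closure ⟨infDist y S, hpos, disjoint_ball_infDist, a, ?_, b, ?_, hab⟩)
  · exact ⟨by rw [mem_sphere, dist_comm, hda], ha⟩
  · exact ⟨by rw [mem_sphere, dist_comm, hdb], hb⟩

open Metric Set in
/-- A ball that touches `S` at `q`, with center in a closed ball whose interior is disjoint from
the medial axis and contains `q`, does not meet `S`, if this is true of small balls with the same
normal. -/
theorem ball_disjoint_of_disjoint_medialAxis {S : Set (EuclideanSpace ℝ (Fin d))}
    (hS : IsCompact S) {p q m : EuclideanSpace ℝ (Fin d)} {R : ℝ}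
    (hR : ∀ y ∈ ball p R, y ∉ medialAxis S) (hq : q ∈ S) (hqp : ‖q - p‖ < R) (hm : ‖m‖ = 1)
    (hsmall : ∃ t₀ > 0, ∀ t, 0 ≤ t → t ≤ t₀ → ∀ a ∈ S, t ≤ dist (q + t • m) a)
    {s : ℝ} (hs : 0 ≤ s) (hsR : ‖q + s • m - p‖ ≤ R) :
    ∀ a ∈ S, s ≤ dist (q + s • m) a := by
  obtain ⟨t₀, ht₀, hsmall⟩ := hsmall
  -- At the largest empty radius t < s the center lies strictly inside the ball of radius R, as a
  -- convex combination of q and the final center; so it can be inflated further.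
  set I := Icc (0 : ℝ) s ∩ {t | ∀ a ∈ S, t ≤ dist (q + t • m) a} with hI
  have hIc : IsCompact I := by
    refine isCompact_Icc.inter_right ?_
    simp only [ofPred_forall]
    refine isClosed_biInter fun a _ => isClosed_le continuous_id (by fun_prop)
  have h0 : (0 : ℝ) ∈ I := ⟨⟨le_rfl, hs⟩, fun a _ => dist_nonneg⟩
  obtain ⟨t, htI, htmax⟩ := hIc.exists_isMaxOn ⟨0, h0⟩ continuousOn_id
  have htmax' : ∀ r ∈ I, r ≤ t := fun r hr => htmax hr
  have hts : t ≤ s := htI.1.2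
  rcases hts.lt_or_eq with hlt | rfl
  swap
  · exact htI.2
  exfalso
  have htpos : 0 < t := by
    have hmin : 0 < min t₀ s := lt_min ht₀ (htI.1.1.trans_lt hlt)
    exact hmin.trans_le (htmax' _ ⟨⟨hmin.le, min_le_right _ _⟩, hsmall _ hmin.le (min_le_left _ _)⟩)
  have hx : ‖q + t • m - p‖ < R := by
    have hs0 : 0 < s := htpos.trans hlt
    have e : q + t • m - p = (1 - t / s) • (q - p) + (t / s) • (q + s • m - p) := by
      have : (t / s) • s • m = t • m := by rw [smul_smul, div_mul_cancel₀ _ hs0.ne']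
      rw [show (t / s) • (q + s • m - p) = (t / s) • (q - p) + (t / s) • s • m by
        rw [← smul_add]; congr 1; abel, this, sub_smul, one_smul]
      abel
    have hr1 : t / s < 1 := (div_lt_one hs0).2 hlt
    have hr0 : 0 < t / s := by positivity
    rw [e]
    refine (norm_add_le _ _).trans_lt ?_
    rw [norm_smul, norm_smul, Real.norm_of_nonneg (by linarith), Real.norm_of_nonneg hr0.le]
    nlinarith [mul_lt_mul_of_pos_left hqp (by linarith : 0 < 1 - t / s)]
  set r := min ((R - ‖q + t • m - p‖) / 2) (s - t) with hr
  have hr0 : 0 < r := lt_min (by linarith) (by linarith)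
  have hext := ball_extend hS hq hm htpos hr0.le htI.2 (by
    intro y hy hypos
    refine nearest_unique_of_notMem_medialAxis (hR y ?_) hypos
    rw [mem_closedBall, dist_eq_norm] at hy
    rw [mem_ball, dist_eq_norm]
    have h1 := norm_add_le (y - (q + t • m)) (q + t • m - p)
    rw [sub_add_sub_cancel] at h1
    have h2 := min_le_left ((R - ‖q + t • m - p‖) / 2) (s - t)
    rw [← hr] at h2
    linarith)
  have := htmax' (t + r) ⟨⟨by linarith, by linarith [min_le_right ((R - ‖q + t • m - p‖) / 2) (s - t)]⟩, hext⟩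
  linarith

end Distance

/-! ### Real inequalities behind the geometric estimates. -/

section Reals

/-- Numerical form of the transversality estimate. -/
theorem transversality_numeric {ρ ν w e s : ℝ} (hρ : 0 < ρ) (hρ2 : ρ ^ 2 ≤ 1 / 2) (hν0 : 0 ≤ ν)
    (hν1 : ν < 1) (hν : 2 * ν ≤ ρ ^ 2 + ν ^ 2) (hw0 : 0 ≤ w) (hw1 : w < 1)
    (hw : 2 * w ≤ ρ ^ 2 + w ^ 2) (he0 : 0 ≤ e) (he : e ^ 2 = 1 - ν ^ 2)
    (hs : 1 - ρ ^ 2 - ν ^ 2 ≤ s ^ 2) (hse : s ^ 2 ≤ (e - ρ) ^ 2 + (w + ν) ^ 2) : False := by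
  -- The hypothesis says (1 - x)² ≥ 1 - ρ² ≥ 1/2, so x ≤ 1 - 1/√2 < 0.295; then x ≤ ρ² / (2 - x) and
  -- 1 / 1.705 < 0.59. Below, 0.3481 = 0.59².
  have bound : ∀ x : ℝ, 0 ≤ x → x < 1 → 2 * x ≤ ρ ^ 2 + x ^ 2 → x ≤ 0.59 * ρ ^ 2 := by
    intro x hx0 hx1 hx
    have h1 : x ≤ 0.295 := by nlinarith
    nlinarith
  have hν' := bound ν hν0 hν1 hν
  have hw' := bound w hw0 hw1 hw
  have h4 : ν ^ 2 ≤ 0.3481 * ρ ^ 4 := by nlinarith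
  have h5 : (w + ν) ^ 2 ≤ 4 * (0.3481 * ρ ^ 4) := by nlinarith
  have h6 : 2 * ρ * e ≤ 2 * ρ ^ 2 + 4 * (0.3481 * ρ ^ 4) := by nlinarith
  have h7 : e ≤ ρ * (1 + 0.6962 * ρ ^ 2) := by
    have : ρ * e ≤ ρ * (ρ * (1 + 0.6962 * ρ ^ 2)) := by nlinarith
    exact le_of_mul_le_mul_left this hρ
  have h8 : e ^ 2 ≤ ρ ^ 2 * (1 + 0.6962 * ρ ^ 2) ^ 2 := by
    rw [← mul_pow]; exact pow_le_pow_left₀ he0 h7 2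
  have h9 : (1 + 0.6962 * ρ ^ 2) ^ 2 ≤ (1.3481 : ℝ) ^ 2 := by
    apply pow_le_pow_left₀ (by positivity); linarith
  have h10 : ρ ^ 2 * (1 + 0.6962 * ρ ^ 2) ^ 2 ≤ 1 / 2 * 1.3481 ^ 2 := by
    apply mul_le_mul hρ2 h9 (by positivity) (by norm_num)
  have h11 : ρ ^ 4 ≤ 1 / 4 := by nlinarith [sq_nonneg ρ]
  norm_num at h10
  linarith

/-- Numerical form of the estimate for the normal part of the center of a ball. -/
theorem center_numeric {b L w s : ℝ} (hL : 0 ≤ L) (hL2 : L ^ 2 = 2 + 2 * b) (hb : 0 ≤ b)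
    (hw0 : 0 ≤ w) (hw1 : w < 1) (hw : 2 * w ≤ (1 - b) / 2 + w ^ 2)
    (hs : s ^ 2 ≤ (1 - b ^ 2) * (1 - 1 / L) ^ 2 + (b + w) ^ 2) :
    (s ^ 2 + 2 * s - 1) / 2 ≤ b := by
  have hL1 : 1 < L := by nlinarith
  have hw' : w ≤ 1 - L / 2 := by
    have h1 : (L / 2) ^ 2 ≤ (1 - w) ^ 2 := by nlinarith
    have := (pow_le_pow_iff_left₀ (by positivity) (by linarith) two_ne_zero).1 h1
    linarith
  have h2 : (b + w) ^ 2 ≤ (b + (1 - L / 2)) ^ 2 := by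
    apply pow_le_pow_left₀ (by positivity); linarith
  have hbL : b = L ^ 2 / 2 - 1 := by linarith
  -- The distance from c to the unit sphere about -n, where L = |c + n|, split into tangential and
  -- normal parts.
  have h3 : (1 - b ^ 2) * (1 - 1 / L) ^ 2 + (b + (1 - L / 2)) ^ 2 = (L - 1) ^ 2 := by
    rw [hbL]; field_simp; ring
  have h4 : s ≤ L - 1 := by
    exact le_of_abs_le (abs_le_of_sq_le_sq (by linarith) (by linarith))
  nlinarith

/-- Combination of the estimates for the two balls with opposite normals. -/
theorem combine_numeric {s r σ μ α η b c : ℝ} (hs : 0 < s) (hr : 0 < r) (hs1 : s ≤ 1) (hr1 : r ≤ 1)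
    (hσ : 0 < σ) (hsr : s * r = σ ^ 2) (hσ2 : (0.381 : ℝ) ≤ σ ^ 2)
    (hb0 : 0 ≤ b) (hc0 : 0 ≤ c)
    (hb : (s ^ 2 + 2 * s - 1) / 2 ≤ b) (hc : (r ^ 2 + 2 * r - 1) / 2 ≤ c)
    (hb2 : b ^ 2 = η ^ 2 + 2 * s * α + s ^ 2 * μ ^ 2)
    (hc2 : c ^ 2 = η ^ 2 - 2 * r * α + r ^ 2 * μ ^ 2) :
    (1 - (1 - σ ^ 2) / (2 * σ)) ^ 2 - η ^ 2 / σ ^ 2 ≤ μ ^ 2 := by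
  -- The weights r and s cancel the terms in α.
  have hsum : r * b ^ 2 + s * c ^ 2 = (s + r) * (η ^ 2 + σ ^ 2 * μ ^ 2) := by
    rw [hb2, hc2, ← hsr]; ring
  have key : (s + r) * (σ ^ 2 * (1 - (1 - σ ^ 2) / (2 * σ)) ^ 2) ≤ r * b ^ 2 + s * c ^ 2 := by
    have hf : σ ^ 2 * (1 - (1 - σ ^ 2) / (2 * σ)) ^ 2 = ((σ ^ 2 + 2 * σ - 1) / 2) ^ 2 := by
      field_simp; ring
    rw [hf]
    have hσ1 : 0.617 ≤ σ := le_of_abs_le (abs_le_of_sq_le_sq (by norm_num; linarith) hσ.le)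
    -- A negative lower bound for b cannot be squared. In that case s < √2 - 1 < 0.415, so r ≥ 0.381
    -- / 0.415 is near 1, and the term s * c ^ 2 alone suffices.
    have small : ∀ s r b c : ℝ, 0 < s → 0 < r → s ≤ 1 → r ≤ 1 → s * r = σ ^ 2 → 0 ≤ b → 0 ≤ c →
        (r ^ 2 + 2 * r - 1) / 2 ≤ c → s ^ 2 + 2 * s - 1 < 0 →
        (s + r) * ((σ ^ 2 + 2 * σ - 1) / 2) ^ 2 ≤ r * b ^ 2 + s * c ^ 2 := by
      intro s r b c hs hr hs1 hr1 hsr hb0 hc0 hc hneg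
      have h1 : s < 0.415 := by
        by_contra! hcon
        have : (0.415 : ℝ) ^ 2 ≤ s ^ 2 := pow_le_pow_left₀ (by norm_num) hcon 2
        norm_num at this
        linarith
      have h1' : s * r ≤ 0.415 * r := mul_le_mul_of_nonneg_right h1.le hr.le
      have h2 : 0.918 ≤ r := by linarith
      have h3' : s * r ≤ s * 1 := mul_le_mul_of_nonneg_left hr1 hs.le
      have h3 : 0.38 ≤ s := by linarith
      have h5' : s * r ≤ 0.415 * 1 := mul_le_mul h1.le hr1 hr.le (by norm_num)
      have hr2 : (0.918 : ℝ) ^ 2 ≤ r ^ 2 := pow_le_pow_left₀ (by norm_num) h2 2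
      norm_num at hr2
      have h4 : 0.83 ≤ c := by linarith
      have h5 : σ ≤ 0.645 :=
        le_of_abs_le (abs_le_of_sq_le_sq (by norm_num; linarith) (by norm_num))
      have h6 : 0 ≤ (σ ^ 2 + 2 * σ - 1) / 2 := by linarith
      have h7 : (σ ^ 2 + 2 * σ - 1) / 2 ≤ 0.36 := by linarith
      have h8 : ((σ ^ 2 + 2 * σ - 1) / 2) ^ 2 ≤ 0.36 ^ 2 := pow_le_pow_left₀ h6 h7 2
      have h9 : (0.83 : ℝ) ^ 2 ≤ c ^ 2 := pow_le_pow_left₀ (by norm_num) h4 2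
      have h10 : (s + r) * ((σ ^ 2 + 2 * σ - 1) / 2) ^ 2 ≤ 1.415 * 0.36 ^ 2 :=
        mul_le_mul (by linarith) h8 (by positivity) (by norm_num)
      have h11 : (0.38 : ℝ) * 0.83 ^ 2 ≤ s * c ^ 2 := mul_le_mul h3 h9 (by positivity) hs.le
      have h12 : 0 ≤ r * b ^ 2 := by positivity
      norm_num at h10 h11
      linarith
    rcases lt_or_ge (s ^ 2 + 2 * s - 1) 0 with h1 | h1
    · exact small s r b c hs hr hs1 hr1 hsr hb0 hc0 hc h1
    rcases lt_or_ge (r ^ 2 + 2 * r - 1) 0 with h2 | h2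
    · have := small r s c b hr hs hr1 hs1 (by rw [mul_comm, hsr]) hc0 hb0 hb h2
      linarith
    have hb' : ((s ^ 2 + 2 * s - 1) / 2) ^ 2 ≤ b ^ 2 := pow_le_pow_left₀ (by linarith) hb 2
    have hc' : ((r ^ 2 + 2 * r - 1) / 2) ^ 2 ≤ c ^ 2 := pow_le_pow_left₀ (by linarith) hc 2
    have hY : 2 * σ ≤ s + r := by
      refine le_of_abs_le (abs_le_of_sq_le_sq ?_ (by linarith))
      nlinarith [sq_nonneg (s - r)]
    -- For fixed product s r = σ², the excess over the symmetric case s = r = σ has the factor s + r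
    -- - 2σ, nonnegative by AM-GM.
    have hid : r * ((s ^ 2 + 2 * s - 1) / 2) ^ 2 + s * ((r ^ 2 + 2 * r - 1) / 2) ^ 2 -
        (s + r) * ((σ ^ 2 + 2 * σ - 1) / 2) ^ 2 =
        (s + r - 2 * σ) * (σ ^ 2 * (s + r + σ) + σ + σ ^ 2 * (s + r) * (s + r + 2 * σ) / 4) := by
      linear_combination (((s + r) ^ 3 + 4 * (s + r) ^ 2 + 2 * (s + r) - 8) -
        (3 * (s + r) + 8) * (s * r + σ ^ 2)) / 4 * hsr
    have h3 : 0 ≤ (s + r - 2 * σ) *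
        (σ ^ 2 * (s + r + σ) + σ + σ ^ 2 * (s + r) * (s + r + 2 * σ) / 4) :=
      mul_nonneg (by linarith) (by positivity)
    nlinarith [mul_le_mul_of_nonneg_left hb' hr.le, mul_le_mul_of_nonneg_left hc' hs.le]
  rw [hsum] at key
  have h1 := le_of_mul_le_mul_left key (by positivity)
  have h2 : (1 - (1 - σ ^ 2) / (2 * σ)) ^ 2 ≤ (η ^ 2 + σ ^ 2 * μ ^ 2) / σ ^ 2 := by
    rw [le_div_iff₀ (by positivity)]; linarith
  have h3 : (η ^ 2 + σ ^ 2 * μ ^ 2) / σ ^ 2 = η ^ 2 / σ ^ 2 + μ ^ 2 := by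
    field_simp
  linarith

end Reals

/-! ### The surface at scale one: lifting, transversality and normal variation. -/

section Normalized

variable {E : Type*} [NormedAddCommGroup E] [InnerProductSpace ℝ E]

/-- The length at which the ray from `a` in the direction `m` leaves the unit ball. -/
theorem exists_exit_length {a m : E} (ha : ‖a‖ < 1) (hm : ‖m‖ = 1) :
    ‖a + (-inner ℝ a m + √(inner ℝ a m ^ 2 + (1 - ‖a‖ ^ 2))) • m‖ = 1 ∧
      0 < -inner ℝ a m + √(inner ℝ a m ^ 2 + (1 - ‖a‖ ^ 2)) := by
  have h1 : 0 < 1 - ‖a‖ ^ 2 := by nlinarith [norm_nonneg a]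
  set β := inner ℝ a m
  have h2 := Real.sq_sqrt (show 0 ≤ β ^ 2 + (1 - ‖a‖ ^ 2) by positivity)
  have h3 := Real.sqrt_nonneg (β ^ 2 + (1 - ‖a‖ ^ 2))
  set w := √(β ^ 2 + (1 - ‖a‖ ^ 2))
  constructor
  · have : ‖a + (-β + w) • m‖ ^ 2 = 1 := by
      rw [norm_add_sq_real, norm_smul, hm, real_inner_smul_right, mul_one, Real.norm_eq_abs, sq_abs]
      change ‖a‖ ^ 2 + 2 * ((-β + w) * β) + (-β + w) ^ 2 = 1
      linear_combination h2
    exact (pow_eq_one_iff_of_nonneg (norm_nonneg _) two_ne_zero).1 this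
  · have : β < w := by
      apply lt_of_pow_lt_pow_left₀ 2 h3
      rw [h2]; linarith
    linarith

variable [FiniteDimensional ℝ E]

open Topology in
/-- A closed set through the origin with tangent spaces `T a`, such that the balls that touch it
at a point of the open unit ball and have their center in the closed unit ball do not meet it. -/
structure IsNormalizedSurface (S : Set E) (T : E → Submodule ℝ E) : Prop where
  isClosed : IsClosed S
  zero_mem : (0 : E) ∈ S
  le_norm_sub : ∀ a ∈ S, ‖a‖ < 1 → ∀ m ∈ (T a)ᗮ, ‖m‖ = 1 → ∀ s : ℝ, 0 ≤ s → ‖a + s • m‖ ≤ 1 →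
    ∀ x ∈ S, s ≤ ‖a + s • m - x‖
  eventually_lift : ∀ a ∈ S, (∀ m ∈ T 0, m ∈ (T a)ᗮ → m = 0) → ∀ U ∈ 𝓝 a,
    ∀ᶠ t in 𝓝 ((T 0).orthogonalProjectionOnto a),
      ∃ x ∈ S, x ∈ U ∧ (T 0).orthogonalProjectionOnto x = t

theorem norm_sq_eq_starProjection_add_sub (P : Submodule ℝ E) (v : E) :
    ‖v‖ ^ 2 = ‖P.starProjection v‖ ^ 2 + ‖v - P.starProjection v‖ ^ 2 := by
  rw [← P.starProjection_orthogonal_val, ← Submodule.norm_sq_eq_add_norm_sq_starProjection]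

namespace IsNormalizedSurface

variable {S : Set E} {T : E → Submodule ℝ E}

/-- The unit ball tangent at 0 whose center lies along the normal part of x does not contain x. -/
theorem two_mul_norm_normal_le (h : IsNormalizedSurface S T) {x : E} (hx : x ∈ S) :
    2 * ‖x - (T 0).starProjection x‖ ≤ ‖x‖ ^ 2 := by
  set n := x - (T 0).starProjection x with hn
  by_cases h0 : n = 0
  · rw [h0, norm_zero, mul_zero]; positivity
  have hpos : 0 < ‖n‖ := norm_pos_iff.2 h0
  have hm : ‖‖n‖⁻¹ • n‖ = 1 := by
    rw [norm_smul, norm_inv, norm_norm, inv_mul_cancel₀ hpos.ne']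
  have hnT : n ∈ (T 0)ᗮ := (T 0).sub_starProjection_mem_orthogonal x
  have h1 := h.le_norm_sub 0 h.zero_mem (by simp) _ ((T 0)ᗮ.smul_mem _ hnT) hm 1 zero_le_one
    (by rw [zero_add, one_smul, hm]) x hx
  rw [zero_add, one_smul] at h1
  have hin : inner ℝ n x = ‖n‖ ^ 2 := by
    have : inner ℝ n ((T 0).starProjection x) = 0 :=
      (T 0).starProjection_inner_eq_zero x _ ((T 0).starProjection_apply_mem x)
    rw [← real_inner_self_eq_norm_sq]
    nth_rw 3 [hn]
    rw [inner_sub_right, this, sub_zero]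
  have h2 : (1 : ℝ) ≤ ‖‖n‖⁻¹ • n - x‖ ^ 2 := one_le_pow₀ h1
  rw [norm_sub_sq_real, hm, real_inner_smul_left, hin] at h2
  have h3 : ‖n‖⁻¹ * ‖n‖ ^ 2 = ‖n‖ := by field_simp
  rw [h3] at h2
  linarith

/-- A gap: over the disk, normal parts below 1 are at most 1/2. It makes the sheet both open and
closed in the surface over the disk. -/
theorem norm_normal_le_half (h : IsNormalizedSurface S T) {x : E} (hx : x ∈ S)
    (hT : ‖(T 0).starProjection x‖ ^ 2 ≤ 1 / 2) (h1 : ‖x - (T 0).starProjection x‖ < 1) :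
    ‖x - (T 0).starProjection x‖ ≤ 1 / 2 := by
  have h2 := h.two_mul_norm_normal_le hx
  rw [norm_sq_eq_starProjection_add_sub (T 0) x] at h2
  nlinarith [norm_nonneg (x - (T 0).starProjection x)]

/-- The part of `S` over a disk of its tangent space at the origin. -/
def sheet (S : Set E) (T : E → Submodule ℝ E) : Set E :=
  S ∩ {x | ‖x - (T 0).starProjection x‖ ≤ 1 / 2 ∧ ‖(T 0).starProjection x‖ ^ 2 ≤ 1 / 2}

theorem isCompact_sheet (h : IsNormalizedSurface S T) : IsCompact (sheet S T) := by
  have : ProperSpace E := FiniteDimensional.proper ℝ E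
  refine Metric.isCompact_of_isClosed_isBounded ?_ ?_
  · have h1 : IsClosed {x | ‖x - (T 0).starProjection x‖ ≤ 1 / 2} :=
      isClosed_le (by fun_prop) continuous_const
    have h2 : IsClosed {x | ‖(T 0).starProjection x‖ ^ 2 ≤ 1 / 2} :=
      isClosed_le (by fun_prop) continuous_const
    exact h.isClosed.inter (h1.inter h2)
  · refine (Metric.isBounded_closedBall (x := (0 : E)) (r := 1)).subset ?_
    rintro x ⟨-, h1, h2⟩
    rw [mem_closedBall_zero_iff]
    have h3 := norm_sq_eq_starProjection_add_sub (T 0) x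
    nlinarith [norm_nonneg (x - (T 0).starProjection x), norm_nonneg x]

/-- If the surface extends over the disk of radius `ρ`, then it is transverse to the normal
directions of the tangent space over the boundary of this disk. -/
theorem transverse_of_lift (h : IsNormalizedSurface S T) {ρ : ℝ}
    (hlift : ∀ t ∈ T 0, ‖t‖ ≤ ρ → ∃ z ∈ sheet S T, (T 0).starProjection z = t)
    {x : E} (hx : x ∈ sheet S T) (hρ : ‖(T 0).starProjection x‖ = ρ) :
    ∀ m ∈ T 0, m ∈ (T x)ᗮ → m = 0 := by
  obtain ⟨hxS, hx1, hx2⟩ := hx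
  have hxsq := norm_sq_eq_starProjection_add_sub (T 0) x
  have hxt := h.two_mul_norm_normal_le hxS
  have hν0 := norm_nonneg (x - (T 0).starProjection x)
  have hρ0 : 0 ≤ ρ := hρ ▸ norm_nonneg _
  rcases hρ0.eq_or_lt with hρz | hρpos
  · have h1 : x - (T 0).starProjection x = 0 := by
      rw [← norm_eq_zero]
      rw [hρ, ← hρz] at hxsq
      nlinarith
    have h2 : (T 0).starProjection x = 0 := by rw [← norm_eq_zero, hρ, hρz]
    have h3 : x = 0 := by rw [h2, sub_zero] at h1; exact h1
    subst h3
    intro m hm hm'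
    exact inner_self_eq_zero.1 (hm' m hm)
  have hx_lt : ‖x‖ < 1 := by nlinarith [norm_nonneg x]
  -- A horizontal normal m pointing inward gives an empty ball whose center c has the same height as
  -- x and whose radius satisfies s² ≥ 1 - ‖x‖². The point z of the sheet over the radial projection
  -- of c to the circle of radius ρ is too close to c.
  have key : ∀ m ∈ T 0, m ∈ (T x)ᗮ → ‖m‖ = 1 → inner ℝ x m ≤ 0 → False := by
    intro m hm hm' hm1 hin
    obtain ⟨hc1, hs⟩ := exists_exit_length hx_lt hm1
    set s := -inner ℝ x m + √(inner ℝ x m ^ 2 + (1 - ‖x‖ ^ 2)) with hsdef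
    have hPm : (T 0).starProjection m = m := (T 0).starProjection_eq_self_iff.2 hm
    have hcT : (T 0).starProjection (x + s • m) = (T 0).starProjection x + s • m := by
      rw [map_add, map_smul, hPm]
    have hcN : x + s • m - (T 0).starProjection (x + s • m) = x - (T 0).starProjection x := by
      rw [hcT]; abel
    have hcsq := norm_sq_eq_starProjection_add_sub (T 0) (x + s • m)
    rw [hc1, hcN] at hcsq
    set cT := (T 0).starProjection (x + s • m) with hcTdef
    have he : 0 < ‖cT‖ := by
      by_contra! hcon
      have : ‖cT‖ = 0 := le_antisymm hcon (norm_nonneg _)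
      rw [this] at hcsq
      nlinarith
    obtain ⟨z, ⟨hzS, hz1, hz2⟩, hzt⟩ := hlift ((ρ / ‖cT‖) • cT)
      ((T 0).smul_mem _ ((T 0).starProjection_apply_mem _)) (by
        rw [norm_smul, Real.norm_of_nonneg (by positivity), div_mul_cancel₀ _ he.ne'])
    have hzn : ‖(T 0).starProjection z‖ = ρ := by
      rw [hzt, norm_smul, Real.norm_of_nonneg (by positivity), div_mul_cancel₀ _ he.ne']
    have hdist := h.le_norm_sub x hxS hx_lt m hm' hm1 s hs.le hc1.le z hzS
    have hdsq := norm_sq_eq_starProjection_add_sub (T 0) (x + s • m - z)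
    rw [map_sub, ← hcTdef, hzt] at hdsq
    have e1 : ‖cT - (ρ / ‖cT‖) • cT‖ ^ 2 = (‖cT‖ - ρ) ^ 2 := by
      have : cT - (ρ / ‖cT‖) • cT = (1 - ρ / ‖cT‖) • cT := by rw [sub_smul, one_smul]
      rw [this, norm_smul, mul_pow, Real.norm_eq_abs, sq_abs, ← mul_pow]
      congr 1
      field_simp
    have e2 : ‖x + s • m - z - (cT - (ρ / ‖cT‖) • cT)‖ ≤
        ‖z - (T 0).starProjection z‖ + ‖x - (T 0).starProjection x‖ := by
      have : x + s • m - z - (cT - (ρ / ‖cT‖) • cT) =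
          (x - (T 0).starProjection x) - (z - (T 0).starProjection z) := by
        rw [hzt, hcT]; abel
      rw [this, add_comm]
      exact norm_sub_le _ _
    have hzsq := norm_sq_eq_starProjection_add_sub (T 0) z
    have hzt' := h.two_mul_norm_normal_le hzS
    rw [hzsq, hzn] at hzt'
    rw [hxsq, hρ] at hxt
    rw [hρ] at hx2 hxsq
    have hs2 : 1 - ρ ^ 2 - ‖x - (T 0).starProjection x‖ ^ 2 ≤ s ^ 2 := by
      have h1 : ‖x + s • m‖ ^ 2 = ‖x‖ ^ 2 + 2 * (s * inner ℝ x m) + s ^ 2 := by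
        rw [norm_add_sq_real, norm_smul, hm1, real_inner_smul_right, mul_one, Real.norm_eq_abs,
          sq_abs]
      rw [hc1] at h1
      nlinarith
    refine transversality_numeric hρpos hx2 hν0 (by linarith) hxt (norm_nonneg _)
      (by linarith) hzt' he.le (by linarith) hs2 ?_
    have h3 : s ^ 2 ≤ ‖x + s • m - z‖ ^ 2 := pow_le_pow_left₀ hs.le hdist 2
    have h4 := pow_le_pow_left₀ (norm_nonneg _) e2 2
    linarith
  intro m hm hm'
  by_contra hm0
  have hpos : 0 < ‖m‖ := norm_pos_iff.2 hm0
  have hn : ‖‖m‖⁻¹ • m‖ = 1 := by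
    rw [norm_smul, norm_inv, norm_norm, inv_mul_cancel₀ hpos.ne']
  have h1 := (T 0).smul_mem ‖m‖⁻¹ hm
  have h2 := (T x)ᗮ.smul_mem ‖m‖⁻¹ hm'
  rcases le_total (inner ℝ x (‖m‖⁻¹ • m)) 0 with h3 | h3
  · exact key _ h1 h2 hn h3
  · exact key _ ((T 0).neg_mem h1) ((T x)ᗮ.neg_mem h2) (by rw [norm_neg, hn])
      (by rw [inner_neg_right]; linarith)

open Metric Topology in
/-- The surface extends over a disk of its tangent space at the origin. -/
theorem exists_lift (h : IsNormalizedSurface S T) :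
    ∀ t ∈ T 0, ‖t‖ ^ 2 ≤ 1 / 2 → ∃ z ∈ sheet S T, (T 0).starProjection z = t := by
  have : ProperSpace (T 0) := FiniteDimensional.proper ℝ (T 0)
  set G : Set (T 0) := (T 0).orthogonalProjectionOnto '' sheet S T with hG
  have hGc : IsClosed G := (h.isCompact_sheet.image (by fun_prop)).isClosed
  have hGiff : ∀ t : T 0, t ∈ G ↔ ∃ z ∈ sheet S T, (T 0).starProjection z = t := by
    intro t
    simp only [hG, Set.mem_image, Submodule.starProjection_apply, Subtype.ext_iff]
  set D : Set (T 0) := {t | ‖t‖ ^ 2 ≤ 1 / 2} with hD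
  have hDc : IsClosed D := isClosed_le (by fun_prop) continuous_const
  suffices hDG : D ⊆ G by
    intro t ht htn
    exact (hGiff ⟨t, ht⟩).1 (hDG htn)
  by_contra hcon
  rw [Set.not_subset] at hcon
  obtain ⟨t₁, ht₁D, ht₁G⟩ := hcon
  have hsub : closure (D \ G) ⊆ D := closure_minimal Set.sdiff_subset hDc
  have hcomp : IsCompact (closure (D \ G)) := by
    refine isCompact_of_isClosed_isBounded isClosed_closure ?_
    refine (isBounded_closedBall (x := (0 : T 0)) (r := 1)).subset (hsub.trans ?_)
    intro t (ht : ‖t‖ ^ 2 ≤ 1 / 2)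
    rw [mem_closedBall_zero_iff]
    nlinarith [norm_nonneg t]
  -- A boundary point of the unlifted set nearest to the origin: the closed disk up to t is lifted,
  -- so the surface is transverse there and projects openly, which lifts the nearby points too.
  obtain ⟨t, ht, htmin⟩ := hcomp.exists_isMinOn ⟨t₁, subset_closure ⟨ht₁D, ht₁G⟩⟩
    (f := fun t => ‖t‖) (by fun_prop)
  have htmin' : ∀ u ∈ closure (D \ G), ‖t‖ ≤ ‖u‖ := fun u hu => htmin hu
  have htD : ‖t‖ ^ 2 ≤ 1 / 2 := hsub ht
  have hball : ∀ u : T 0, ‖u‖ < ‖t‖ → u ∈ G := by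
    intro u hu
    by_contra huG
    have huD : u ∈ D := (pow_le_pow_left₀ (norm_nonneg u) hu.le 2).trans htD
    exact absurd (htmin' u (subset_closure ⟨huD, huG⟩)) (not_le.2 hu)
  have h0G : (0 : T 0) ∈ G := by
    rw [hGiff]
    refine ⟨0, ⟨h.zero_mem, ?_⟩, by simp⟩
    norm_num
  have hcball : ∀ u : T 0, ‖u‖ ≤ ‖t‖ → u ∈ G := by
    intro u hu
    by_cases ht0 : ‖t‖ = 0
    · have : u = 0 := by rw [← norm_le_zero_iff]; linarith
      rwa [this]
    have : u ∈ closure (ball (0 : T 0) ‖t‖) := by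
      rw [closure_ball _ ht0]; simpa using hu
    exact closure_minimal (fun v hv => hball v (by simpa using hv)) hGc this
  obtain ⟨x, hx, hxt⟩ := (hGiff t).1 (hcball t le_rfl)
  have htrans := h.transverse_of_lift (ρ := ‖t‖)
    (fun u hu hun => (hGiff ⟨u, hu⟩).1 (hcball ⟨u, hu⟩ hun)) hx (by rw [hxt]; rfl)
  have hU : {y : E | ‖y - (T 0).starProjection y‖ < 1} ∈ 𝓝 x := by
    refine (isOpen_lt (by fun_prop) continuous_const).mem_nhds ?_
    have := hx.2.1
    change ‖x - (T 0).starProjection x‖ < 1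
    linarith
  have hev := h.eventually_lift x hx.1 htrans _ hU
  have hxt' : (T 0).orthogonalProjectionOnto x = t := by
    rw [Submodule.starProjection_apply] at hxt
    exact Subtype.ext hxt
  rw [hxt'] at hev
  obtain ⟨u, ⟨huD, huG⟩, y, hyS, hyU, hyu⟩ :=
    ((mem_closure_iff_frequently.1 ht).and_eventually hev).exists
  refine huG ((hGiff u).2 ⟨y, ?_, ?_⟩)
  · have hyT : ‖(T 0).starProjection y‖ ^ 2 ≤ 1 / 2 := by
      rw [Submodule.starProjection_apply, hyu]; exact huD
    exact ⟨hyS, h.norm_normal_le_half hyS hyT hyU, hyT⟩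
  · rw [Submodule.starProjection_apply, hyu]

/-- A lower bound for the normal part of the center of a ball that touches the surface. -/
theorem le_norm_normal_center (h : IsNormalizedSurface S T) {a m : E} (ha : a ∈ S) (ha1 : ‖a‖ < 1)
    (hm : m ∈ (T a)ᗮ) (hm1 : ‖m‖ = 1) {s : ℝ} (hs : 0 ≤ s) (hc : ‖a + s • m‖ = 1) :
    (s ^ 2 + 2 * s - 1) / 2 ≤ ‖a + s • m - (T 0).starProjection (a + s • m)‖ := by
  set c := a + s • m with hcdef
  have hcsq := norm_sq_eq_starProjection_add_sub (T 0) c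
  rw [hc] at hcsq
  set b := ‖c - (T 0).starProjection c‖ with hb
  have hb0 : 0 ≤ b := norm_nonneg _
  set L := √(2 + 2 * b) with hL
  have hLpos : 0 < L := Real.sqrt_pos.2 (by linarith)
  have hL2 : L ^ 2 = 2 + 2 * b := Real.sq_sqrt (by linarith)
  have hT2 : ‖(T 0).starProjection c‖ ^ 2 = 1 - b ^ 2 := by linarith
  have htn : ‖(1 / L) • (T 0).starProjection c‖ ^ 2 = (1 - b) / 2 := by
    rw [norm_smul, mul_pow, hT2, Real.norm_eq_abs, sq_abs, div_pow, hL2]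
    field_simp
    ring
  -- This is the tangential part of the point nearest to c on the unit sphere about -n, with n a
  -- unit vector along the normal part of c and L = |c + n|. Its squared norm (1 - b) / 2 is within
  -- reach of the lift.
  obtain ⟨z, ⟨hzS, hz1, -⟩, hzt⟩ := h.exists_lift ((1 / L) • (T 0).starProjection c)
    ((T 0).smul_mem _ ((T 0).starProjection_apply_mem _)) (by rw [htn]; linarith)
  have hdist := h.le_norm_sub a ha ha1 m hm hm1 s hs hc.le z hzS
  have hdsq := norm_sq_eq_starProjection_add_sub (T 0) (c - z)
  rw [map_sub] at hdsq
  have e1 : ‖(T 0).starProjection c - (T 0).starProjection z‖ ^ 2 = (1 - b ^ 2) * (1 - 1 / L) ^ 2 := by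
    have : (T 0).starProjection c - (T 0).starProjection z = (1 - 1 / L) • (T 0).starProjection c := by
      rw [hzt, sub_smul, one_smul]
    rw [this, norm_smul, mul_pow, hT2, Real.norm_eq_abs, sq_abs, mul_comm]
  have e2 : ‖c - z - ((T 0).starProjection c - (T 0).starProjection z)‖ ≤
      b + ‖z - (T 0).starProjection z‖ := by
    rw [sub_sub_sub_comm]
    exact norm_sub_le _ _
  have hzt' := h.two_mul_norm_normal_le hzS
  rw [norm_sq_eq_starProjection_add_sub (T 0) z] at hzt'
  nth_rw 2 [hzt] at hzt'
  rw [htn] at hzt'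
  refine center_numeric hLpos.le hL2 hb0 (norm_nonneg _) (by linarith) hzt' ?_
  have h3 : s ^ 2 ≤ ‖c - z‖ ^ 2 := pow_le_pow_left₀ hs hdist 2
  have h4 := pow_le_pow_left₀ (norm_nonneg _) e2 2
  linarith

/-- The normal variation bound at scale one. -/
theorem normal_variation (h : IsNormalizedSurface S T) {a m : E} (ha : a ∈ S)
    (ha1 : (0.381 : ℝ) ≤ 1 - ‖a‖ ^ 2) (hm : m ∈ (T a)ᗮ) (hm1 : ‖m‖ = 1) :
    (1 - ‖a‖ ^ 2 / (2 * √(1 - ‖a‖ ^ 2))) ^ 2 -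
      ‖a - (T 0).starProjection a‖ ^ 2 / (1 - ‖a‖ ^ 2) ≤ ‖m - (T 0).starProjection m‖ ^ 2 := by
  have hpos : 0 < 1 - ‖a‖ ^ 2 := by norm_num at ha1; linarith
  have ha' : ‖a‖ < 1 := by nlinarith [norm_nonneg a]
  obtain ⟨hc1, hs⟩ := exists_exit_length ha' hm1
  obtain ⟨hc2, hr⟩ := exists_exit_length (m := -m) ha' (by rw [norm_neg, hm1])
  simp only [inner_neg_right, neg_neg, neg_sq] at hc2 hr
  have hw := Real.sq_sqrt (show 0 ≤ inner ℝ a m ^ 2 + (1 - ‖a‖ ^ 2) by positivity)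
  set w := √(inner ℝ a m ^ 2 + (1 - ‖a‖ ^ 2))
  have hσ2 := Real.sq_sqrt hpos.le
  have hσ := Real.sqrt_pos.2 hpos
  set σ := √(1 - ‖a‖ ^ 2)
  have hm' : -m ∈ (T a)ᗮ := (T a)ᗮ.neg_mem hm
  have hm1' : ‖-m‖ = 1 := by rw [norm_neg, hm1]
  have b1 := h.le_norm_normal_center ha ha' hm hm1 hs.le hc1
  have b2 := h.le_norm_normal_center ha ha' hm' hm1' hr.le hc2
  -- The origin is on the surface and at distance 1 from the center, so both radii are at most 1.
  have s1 := h.le_norm_sub a ha ha' m hm hm1 _ hs.le hc1.le 0 h.zero_mem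
  have s2 := h.le_norm_sub a ha ha' (-m) hm' hm1' _ hr.le hc2.le 0 h.zero_mem
  rw [sub_zero, hc1] at s1
  rw [sub_zero, hc2] at s2
  have expand : ∀ (s : ℝ) (m : E), ‖a + s • m - (T 0).starProjection (a + s • m)‖ ^ 2 =
      ‖a - (T 0).starProjection a‖ ^ 2 +
        2 * s * inner ℝ (a - (T 0).starProjection a) (m - (T 0).starProjection m) +
        s ^ 2 * ‖m - (T 0).starProjection m‖ ^ 2 := by
    intro s m
    have : a + s • m - (T 0).starProjection (a + s • m) =
        (a - (T 0).starProjection a) + s • (m - (T 0).starProjection m) := by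
      rw [map_add, map_smul, smul_sub]; abel
    rw [this, norm_add_sq_real, norm_smul, real_inner_smul_right, mul_pow, Real.norm_eq_abs, sq_abs]
    ring
  have x1 := expand (-inner ℝ a m + w) m
  have x2 := expand (inner ℝ a m + w) (-m)
  have hneg : -m - (T 0).starProjection (-m) = -(m - (T 0).starProjection m) := by
    rw [map_neg]; abel
  rw [hneg, inner_neg_right, norm_neg] at x2
  have := combine_numeric (α := inner ℝ (a - (T 0).starProjection a) (m - (T 0).starProjection m))
    hs hr s1 s2 hσ (by rw [hσ2]; linear_combination hw) (by rw [hσ2]; exact ha1)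
    (norm_nonneg _) (norm_nonneg _) b1 b2 x1 (by rw [x2]; ring)
  rw [hσ2] at this
  simpa using this

end IsNormalizedSurface

end Normalized

/-! ### Local facts from smooth charts: tangent spaces, open projections, touching balls. -/

section Charts

variable {d : ℕ}

/-- The coordinate subspace where all coordinates but the first `k` vanish. -/
def coordSubspace (d k : ℕ) : Submodule ℝ (EuclideanSpace ℝ (Fin d)) where
  carrier := {y | ∀ i : Fin d, k ≤ (i : ℕ) → y i = 0}
  add_mem' := fun ha hb i hi => by simp [ha i hi, hb i hi]
  zero_mem' := fun i _ => rfl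
  smul_mem' := fun c x hx i hi => by simp [hx i hi]

open Filter Topology in
/-- Smooth maps `φ`, `ψ`, inverse to each other near `q`, that flatten `S` near `q`. -/
structure IsFlattening (S : Set (EuclideanSpace ℝ (Fin d))) (q : EuclideanSpace ℝ (Fin d))
    (L : Submodule ℝ (EuclideanSpace ℝ (Fin d)))
    (φ ψ : EuclideanSpace ℝ (Fin d) → EuclideanSpace ℝ (Fin d)) : Prop where
  contDiffAt : ContDiffAt ℝ ∞ φ q
  contDiffAt_inv : ContDiffAt ℝ ∞ ψ (φ q)
  left_inv : ∀ᶠ x in 𝓝 q, ψ (φ x) = x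
  right_inv : ∀ᶠ y in 𝓝 (φ q), φ (ψ y) = y
  mem_iff : ∀ᶠ x in 𝓝 q, x ∈ S ↔ φ x ∈ L

theorem IsSmoothSubmanifold.exists_isFlattening {k : ℕ} {S : Set (EuclideanSpace ℝ (Fin d))}
    (hS : IsSmoothSubmanifold k S) {q : EuclideanSpace ℝ (Fin d)} (hq : q ∈ S) :
    ∃ φ ψ, IsFlattening S q (coordSubspace d k) φ ψ := by
  obtain ⟨Φ, hqs, h1, h2, h3⟩ := hS q hq
  have hs := Φ.open_source.mem_nhds hqs
  have ht := Φ.open_target.mem_nhds (Φ.map_source hqs)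
  refine ⟨Φ, Φ.symm, h1.contDiffAt hs, h2.contDiffAt ht, ?_, ?_, ?_⟩
  · filter_upwards [hs] with x hx using Φ.left_inv hx
  · filter_upwards [ht] with y hy using Φ.right_inv hy
  · filter_upwards [hs] with x hx using h3 x hx

namespace IsFlattening

variable {S : Set (EuclideanSpace ℝ (Fin d))} {q : EuclideanSpace ℝ (Fin d)}
  {L : Submodule ℝ (EuclideanSpace ℝ (Fin d))}
  {φ ψ : EuclideanSpace ℝ (Fin d) → EuclideanSpace ℝ (Fin d)}

theorem inv_apply (h : IsFlattening S q L φ ψ) : ψ (φ q) = q := h.left_inv.self_of_nhds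

theorem hasFDerivAt (h : IsFlattening S q L φ ψ) : HasFDerivAt φ (fderiv ℝ φ q) q :=
  (h.contDiffAt.differentiableAt (by simp)).hasFDerivAt

theorem hasFDerivAt_inv (h : IsFlattening S q L φ ψ) :
    HasFDerivAt ψ (fderiv ℝ ψ (φ q)) (φ q) :=
  (h.contDiffAt_inv.differentiableAt (by simp)).hasFDerivAt

theorem fderiv_inv_apply (h : IsFlattening S q L φ ψ) (v : EuclideanSpace ℝ (Fin d)) :
    fderiv ℝ ψ (φ q) (fderiv ℝ φ q v) = v := by
  have h1 := h.hasFDerivAt_inv.comp q h.hasFDerivAt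
  have h2 := (hasFDerivAt_id (𝕜 := ℝ) q).congr_of_eventuallyEq h.left_inv
  exact congrArg (fun f => f v) (h1.unique h2)

theorem fderiv_apply_inv (h : IsFlattening S q L φ ψ) (v : EuclideanSpace ℝ (Fin d)) :
    fderiv ℝ φ q (fderiv ℝ ψ (φ q) v) = v := by
  have h0 : HasFDerivAt φ (fderiv ℝ φ q) (ψ (φ q)) := by rw [h.inv_apply]; exact h.hasFDerivAt
  have h1 := h0.comp (φ q) h.hasFDerivAt_inv
  have h2 := (hasFDerivAt_id (𝕜 := ℝ) (φ q)).congr_of_eventuallyEq h.right_inv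
  exact congrArg (fun f => f v) (h1.unique h2)

open Filter Topology in
theorem eventually_inv_mem (h : IsFlattening S q L φ ψ) :
    ∀ᶠ y in 𝓝 (φ q), y ∈ L → ψ y ∈ S := by
  have hc : Tendsto ψ (𝓝 (φ q)) (𝓝 q) := by
    have := h.contDiffAt_inv.continuousAt.tendsto
    rwa [h.inv_apply] at this
  filter_upwards [hc.eventually h.mem_iff, h.right_inv] with y h1 h2 hy
  rw [h1, h2]
  exact hy

theorem apply_mem (h : IsFlattening S q L φ ψ) (hq : q ∈ S) : φ q ∈ L :=
  h.mem_iff.self_of_nhds.1 hq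

open Filter Topology in
theorem tangentDirections_eq (h : IsFlattening S q L φ ψ) (hq : q ∈ S) :
    tangentDirections S q = L.map (fderiv ℝ ψ (φ q)).toLinearMap := by
  apply le_antisymm
  · refine Submodule.span_le.2 ?_
    rintro v ⟨γ, h0, hγS, hγ⟩
    have hγc : Tendsto γ (𝓝 0) (𝓝 q) := by
      have := hγ.continuousAt.tendsto
      rwa [h0] at this
    refine ⟨fderiv ℝ φ q v, ?_, h.fderiv_inv_apply v⟩
    have hφ : HasFDerivAt φ (fderiv ℝ φ q) (γ 0) := by rw [h0]; exact h.hasFDerivAt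
    -- In the chart the curve stays in L, so the Lᗮ-component of its velocity vanishes.
    have h1 := (Lᗮ.starProjection.hasFDerivAt (x := φ (γ 0))).comp_hasDerivAt 0
      (hφ.comp_hasDerivAt 0 hγ)
    have h2 : HasDerivAt (Lᗮ.starProjection ∘ φ ∘ γ) 0 0 := by
      refine (hasDerivAt_const (0 : ℝ) (0 : EuclideanSpace ℝ (Fin d))).congr_of_eventuallyEq ?_
      filter_upwards [hγc.eventually h.mem_iff, hγS] with t ht htS
      have : φ (γ t) ∈ Lᗮᗮ := L.le_orthogonal_orthogonal (ht.1 htS)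
      exact (Submodule.starProjection_apply_eq_zero_iff _).2 this
    have h3 := h1.unique h2
    have h4 := (Submodule.starProjection_apply_eq_zero_iff _).1 h3
    rwa [Submodule.orthogonal_orthogonal] at h4
  · rintro _ ⟨v, hv, rfl⟩
    refine Submodule.subset_span ⟨fun t => ψ (φ q + t • v), ?_, ?_, ?_⟩
    · simp [h.inv_apply]
    · have hc : Tendsto (fun t : ℝ => φ q + t • v) (𝓝 0) (𝓝 (φ q)) := by
        have : Continuous fun t : ℝ => φ q + t • v := by fun_prop
        simpa using this.tendsto 0
      filter_upwards [hc.eventually h.eventually_inv_mem] with t ht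
      exact ht (L.add_mem (h.apply_mem hq) (L.smul_mem t hv))
    · have h1 : HasDerivAt (fun t : ℝ => φ q + t • v) v 0 := by
        simpa using ((hasDerivAt_id (0 : ℝ)).smul_const v).const_add (φ q)
      have h2 : HasFDerivAt ψ (fderiv ℝ ψ (φ q)) (φ q + (0 : ℝ) • v) := by
        simpa using h.hasFDerivAt_inv
      exact h2.comp_hasDerivAt 0 h1

theorem finrank_tangentDirections (h : IsFlattening S q L φ ψ) (hq : q ∈ S) :
    Module.finrank ℝ (tangentDirections S q) = Module.finrank ℝ L := by
  rw [h.tangentDirections_eq hq]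
  have hinj : Function.Injective (fderiv ℝ ψ (φ q)).toLinearMap :=
    (show Function.LeftInverse (fderiv ℝ φ q) (fderiv ℝ ψ (φ q)) from h.fderiv_apply_inv).injective
  exact (Submodule.equivMapOfInjective _ hinj L).finrank_eq.symm

open Filter Topology in
/-- Where the tangent space is transverse to `Vᗮ`, the projection of `S` to `V` is open. -/
theorem eventually_lift (h : IsFlattening S q L φ ψ) (hq : q ∈ S)
    {V : Submodule ℝ (EuclideanSpace ℝ (Fin d))}
    (hV : ∀ m ∈ V, m ∈ (tangentDirections S q)ᗮ → m = 0) {U : Set (EuclideanSpace ℝ (Fin d))}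
    (hU : U ∈ 𝓝 q) :
    ∀ᶠ t in 𝓝 (V.orthogonalProjectionOnto q),
      ∃ x ∈ S, x ∈ U ∧ V.orthogonalProjectionOnto x = t := by
  have hψ : HasStrictFDerivAt ψ (fderiv ℝ ψ (φ q)) (φ q + ((0 : L) : EuclideanSpace ℝ (Fin d))) := by
    simpa using h.contDiffAt_inv.hasStrictFDerivAt (by simp)
  have hi : HasStrictFDerivAt (fun w : L => φ q + (w : EuclideanSpace ℝ (Fin d))) L.subtypeL 0 :=
    (L.subtypeL.hasStrictFDerivAt).const_add (φ q)
  have hf := (V.orthogonalProjectionOnto.hasStrictFDerivAt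
    (x := ψ (φ q + ((0 : L) : EuclideanSpace ℝ (Fin d))))).comp (0 : L) (hψ.comp (0 : L) hi)
  have hmap := hf.map_nhds_eq_of_surj (by
    -- Surjectivity of the derivative: a vector of V orthogonal to the projected tangent space is
    -- orthogonal to the tangent space itself, hence zero by transversality.
    rw [← Submodule.orthogonal_eq_bot_iff, Submodule.eq_bot_iff]
    intro t ht
    have : (t : EuclideanSpace ℝ (Fin d)) = 0 := by
      refine hV t t.2 ?_
      rw [h.tangentDirections_eq hq]
      rintro _ ⟨w, hw, rfl⟩
      have h1 := ht _ ⟨⟨w, hw⟩, rfl⟩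
      simpa using h1
    exact Subtype.ext this)
  have hc : Tendsto (fun w : L => φ q + (w : EuclideanSpace ℝ (Fin d))) (𝓝 0) (𝓝 (φ q)) := by
    have : Continuous fun w : L => φ q + (w : EuclideanSpace ℝ (Fin d)) := by fun_prop
    simpa using this.tendsto 0
  have hcψ : Tendsto ψ (𝓝 (φ q)) (𝓝 q) := by
    have := h.contDiffAt_inv.continuousAt.tendsto
    rwa [h.inv_apply] at this
  have hmem : {w : L | ψ (φ q + w) ∈ S ∧ ψ (φ q + w) ∈ U} ∈ 𝓝 (0 : L) := by
    filter_upwards [hc.eventually h.eventually_inv_mem, (hcψ.comp hc).eventually hU] with w h1 h2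
    exact ⟨h1 (L.add_mem (h.apply_mem hq) w.2), h2⟩
  have him := image_mem_map (m := fun w : L =>
    V.orthogonalProjectionOnto (ψ (φ q + (w : EuclideanSpace ℝ (Fin d))))) hmem
  rw [hmap] at him
  simp only [ZeroMemClass.coe_zero, add_zero, h.inv_apply] at him
  filter_upwards [him] with t ht
  obtain ⟨w, ⟨h1, h2⟩, h3⟩ := ht
  exact ⟨_, h1, h2, h3⟩

open Filter Topology in
/-- `S` deviates quadratically from its tangent space. -/
theorem exists_inner_le_sq (h : IsFlattening S q L φ ψ) (hq : q ∈ S) :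
    ∃ C > 0, ∀ᶠ x in 𝓝 q, x ∈ S → ∀ m ∈ (tangentDirections S q)ᗮ, ‖m‖ = 1 →
      inner ℝ m (x - q) ≤ C * ‖x - q‖ ^ 2 := by
  set A := fderiv ℝ ψ (φ q) with hA
  have hd1 : ∀ᶠ y in 𝓝 (φ q), DifferentiableAt ℝ ψ y :=
    ((h.contDiffAt_inv.of_le (m := 1) (by simp)).eventually (by simp)).mono
      fun y hy => hy.differentiableAt one_ne_zero
  have hd2 : ContDiffAt ℝ 1 (fderiv ℝ ψ) (φ q) :=
    h.contDiffAt_inv.fderiv_right (by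
      rw [one_add_one_eq_two]
      exact WithTop.coe_le_coe.2 (le_top : (2 : ℕ∞) ≤ ⊤))
  obtain ⟨K, hK, hK'⟩ := (hd2.differentiableAt one_ne_zero).isBigO_sub.exists_pos
  rw [Asymptotics.isBigOWith_iff] at hK'
  obtain ⟨C, hC, hC'⟩ := (h.contDiffAt.differentiableAt (by simp)).isBigO_sub.exists_pos
  rw [Asymptotics.isBigOWith_iff] at hC'
  obtain ⟨ε, hε, hball⟩ := Metric.eventually_nhds_iff_ball.1 (hd1.and hK')
  have hquad : ∀ y ∈ Metric.ball (φ q) ε, ‖ψ y - ψ (φ q) - A (y - φ q)‖ ≤ K * ‖y - φ q‖ * ‖y - φ q‖ := by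
    intro y hy
    have hsub : Metric.closedBall (φ q) ‖y - φ q‖ ⊆ Metric.ball (φ q) ε := by
      apply Metric.closedBall_subset_ball
      rwa [← dist_eq_norm]
    refine Convex.norm_image_sub_le_of_norm_hasFDerivWithin_le' (𝕜 := ℝ)
      (f' := fderiv ℝ ψ) (s := Metric.closedBall (φ q) ‖y - φ q‖) ?_ ?_ (convex_closedBall _ _)
      (Metric.mem_closedBall_self (norm_nonneg _)) ?_
    · intro z hz
      exact (hball z (hsub hz)).1.hasFDerivAt.hasFDerivWithinAt
    · intro z hz
      refine (hball z (hsub hz)).2.trans ?_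
      rw [Metric.mem_closedBall, dist_eq_norm] at hz
      gcongr
    · rw [Metric.mem_closedBall, dist_eq_norm]
  have hφc : Tendsto φ (𝓝 q) (𝓝 (φ q)) := h.contDiffAt.continuousAt.tendsto
  refine ⟨K * C ^ 2, by positivity, ?_⟩
  filter_upwards [hC', h.left_inv, h.mem_iff, hφc.eventually (Metric.ball_mem_nhds _ hε)]
    with x h1 h2 h3 h4 hx m hm hm1
  have hy := h3.1 hx
  have h5 := hquad _ h4
  rw [h2, h.inv_apply] at h5
  have h6 : inner ℝ m (A (φ x - φ q)) = 0 := by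
    rw [real_inner_comm]
    apply hm
    rw [h.tangentDirections_eq hq]
    exact ⟨_, L.sub_mem hy (h.apply_mem hq), rfl⟩
  have h7 := real_inner_le_norm m (x - q - A (φ x - φ q))
  rw [inner_sub_right, h6, hm1, sub_zero, one_mul] at h7
  calc inner ℝ m (x - q) ≤ K * ‖φ x - φ q‖ * ‖φ x - φ q‖ := h7.trans h5
    _ ≤ K * (C * ‖x - q‖) * (C * ‖x - q‖) := by gcongr
    _ = K * C ^ 2 * ‖x - q‖ ^ 2 := by ring

open Filter Topology in
/-- Small balls that touch `S` at `q` do not meet `S`. -/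
theorem exists_small_ball (h : IsFlattening S q L φ ψ) (hq : q ∈ S)
    {m : EuclideanSpace ℝ (Fin d)} (hm : m ∈ (tangentDirections S q)ᗮ) (hm1 : ‖m‖ = 1) :
    ∃ t₀ > 0, ∀ t, 0 ≤ t → t ≤ t₀ → ∀ a ∈ S, t ≤ dist (q + t • m) a := by
  obtain ⟨C, hC, hev⟩ := h.exists_inner_le_sq hq
  obtain ⟨ε, hε, hball⟩ := Metric.eventually_nhds_iff.1 hev
  -- The bound 1 / (2C) handles points near q by the quadratic estimate; ε / 2 keeps points at
  -- distance at least ε outside by the triangle inequality.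
  refine ⟨min (ε / 2) (1 / (2 * C)), by positivity, fun t ht0 ht a ha => ?_⟩
  rw [le_min_iff] at ht
  have htm : ‖t • m‖ = t := by rw [norm_smul, hm1, Real.norm_of_nonneg ht0, mul_one]
  rw [dist_eq_norm, show q + t • m - a = t • m - (a - q) by abel]
  by_cases hd : dist a q < ε
  · have h1 := hball hd ha m hm hm1
    have h2 : t * (2 * C) ≤ 1 := by
      rw [← le_div_iff₀ (by positivity)]; exact ht.2
    apply le_of_sq_le_sq _ (norm_nonneg _)
    rw [norm_sub_sq_real, htm, real_inner_smul_left]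
    nlinarith [mul_le_mul_of_nonneg_left h1 ht0, sq_nonneg ‖a - q‖,
      mul_le_mul_of_nonneg_right h2 (sq_nonneg ‖a - q‖)]
  · rw [dist_eq_norm] at hd
    have h1 := norm_sub_norm_le (a - q) (t • m)
    rw [htm, norm_sub_rev (a - q)] at h1
    linarith

end IsFlattening

end Charts

/-! ### From smooth submanifolds to normalized surfaces; the case of an empty medial axis. -/

section Assembly

variable {d k : ℕ} {S : Set (EuclideanSpace ℝ (Fin d))}

theorem IsSmoothSubmanifold.finrank_tangentDirections (hS : IsSmoothSubmanifold k S)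
    {p : EuclideanSpace ℝ (Fin d)} (hp : p ∈ S) :
    Module.finrank ℝ (tangentDirections S p) = Module.finrank ℝ (coordSubspace d k) := by
  obtain ⟨φ, ψ, h⟩ := hS.exists_isFlattening hp
  exact h.finrank_tangentDirections hp

/-- A ball that touches `S` at `q`, with center in a closed ball whose interior is disjoint from
the medial axis and contains `q`, does not meet `S`. -/
theorem IsSmoothSubmanifold.le_dist_center (hS : IsSmoothSubmanifold k S) (hc : IsCompact S)
    {p q m : EuclideanSpace ℝ (Fin d)} {R : ℝ} (hR : ∀ y ∈ Metric.ball p R, y ∉ medialAxis S)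
    (hq : q ∈ S) (hqp : ‖q - p‖ < R) (hm : m ∈ (tangentDirections S q)ᗮ) (hm1 : ‖m‖ = 1)
    {s : ℝ} (hs : 0 ≤ s) (hsR : ‖q + s • m - p‖ ≤ R) :
    ∀ a ∈ S, s ≤ dist (q + s • m) a := by
  obtain ⟨φ, ψ, h⟩ := hS.exists_isFlattening hq
  exact ball_disjoint_of_disjoint_medialAxis hc hR hq hqp hm1 (h.exists_small_ball hq hm hm1) hs hsR

open Filter Topology in
/-- Moving `p` to the origin and scaling by `R⁻¹` gives a normalized surface. -/
theorem IsSmoothSubmanifold.isNormalizedSurface (hS : IsSmoothSubmanifold k S) (hc : IsCompact S)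
    {p : EuclideanSpace ℝ (Fin d)} (hp : p ∈ S) {R : ℝ} (hR0 : 0 < R)
    (hR : ∀ y ∈ Metric.ball p R, y ∉ medialAxis S) :
    IsNormalizedSurface {a | p + R • a ∈ S} (fun a => tangentDirections S (p + R • a)) where
  isClosed := hc.isClosed.preimage (by fun_prop : Continuous fun a => p + R • a)
  zero_mem := by simpa using hp
  le_norm_sub := by
    intro a ha ha1 m hm hm1 s hs hs1 x hx
    have e : ∀ b : EuclideanSpace ℝ (Fin d), p + R • b - p = R • b := fun b => by abel
    have h1 := hS.le_dist_center hc hR ha (by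
      rw [e, norm_smul, Real.norm_of_nonneg hR0.le]; nlinarith) hm hm1
      (mul_nonneg hR0.le hs) (by
        rw [mul_smul, add_assoc, ← smul_add, e, norm_smul, Real.norm_of_nonneg hR0.le]; nlinarith)
      _ hx
    rw [dist_eq_norm, mul_smul, add_assoc, ← smul_add, add_sub_add_left_eq_sub, ← smul_sub,
      norm_smul, Real.norm_of_nonneg hR0.le] at h1
    exact le_of_mul_le_mul_left h1 hR0
  eventually_lift := by
    intro a ha htrans U hU
    beta_reduce at htrans ⊢
    obtain ⟨φ, ψ, h⟩ := hS.exists_isFlattening (q := p + R • a) ha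
    set V := tangentDirections S (p + R • 0)
    have hcont : Continuous fun x : EuclideanSpace ℝ (Fin d) => R⁻¹ • (x - p) := by fun_prop
    have hinv : ∀ a : EuclideanSpace ℝ (Fin d), R⁻¹ • (p + R • a - p) = a := by
      intro a
      rw [add_sub_cancel_left, smul_smul, inv_mul_cancel₀ hR0.ne', one_smul]
    have hinv' : ∀ x : EuclideanSpace ℝ (Fin d), p + R • (R⁻¹ • (x - p)) = x := by
      intro x
      rw [smul_smul, mul_inv_cancel₀ hR0.ne', one_smul, add_sub_cancel]
    have hU' : (fun x => R⁻¹ • (x - p)) ⁻¹' U ∈ 𝓝 (p + R • a) := by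
      apply hcont.continuousAt.preimage_mem_nhds
      rw [hinv]; exact hU
    have hev := h.eventually_lift ha htrans hU'
    have ht : Tendsto (fun t : V => V.orthogonalProjectionOnto p + R • t)
        (𝓝 (V.orthogonalProjectionOnto a)) (𝓝 (V.orthogonalProjectionOnto (p + R • a))) := by
      have : Continuous fun t : V => V.orthogonalProjectionOnto p + R • t := by fun_prop
      rw [map_add, map_smul]
      exact this.tendsto _
    filter_upwards [ht.eventually hev] with t ⟨x, hxS, hxU, hxt⟩
    refine ⟨R⁻¹ • (x - p), ?_, hxU, ?_⟩
    · change p + R • (R⁻¹ • (x - p)) ∈ S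
      rwa [hinv']
    · rw [map_smul, map_sub, hxt, add_sub_cancel_left, smul_smul, inv_mul_cancel₀ hR0.ne', one_smul]

/-- If the medial axis is empty, then all tangent spaces coincide. -/
theorem IsSmoothSubmanifold.tangentDirections_le (hS : IsSmoothSubmanifold k S) (hc : IsCompact S)
    (hM : medialAxis S = ∅) {p q : EuclideanSpace ℝ (Fin d)} (hp : p ∈ S) :
    tangentDirections S q ≤ tangentDirections S p := by
  have hin : ∀ m ∈ (tangentDirections S p)ᗮ, ‖m‖ = 1 → ∀ x ∈ S, inner ℝ m (x - p) ≤ 0 := by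
    intro m hm hm1 x hx
    by_contra! hpos
    set β := inner ℝ m (x - p)
    have hs : 0 ≤ (‖x - p‖ ^ 2 + 1) / (2 * β) := by positivity
    -- With no medial axis, tangent balls of every radius are empty; one this large would contain x.
    -- Using m and -m puts the whole surface in the tangent flat at p.
    set s := (‖x - p‖ ^ 2 + 1) / (2 * β) with hsdef
    have h1 := hS.le_dist_center hc (p := p) (R := s + 1) (by simp [hM]) hp (by
      rw [sub_self, norm_zero]; linarith) hm hm1 hs (by
      rw [add_sub_cancel_left, norm_smul, hm1, Real.norm_of_nonneg hs]; linarith) x hx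
    rw [dist_eq_norm, show p + s • m - x = s • m - (x - p) by abel] at h1
    have h2 := pow_le_pow_left₀ hs h1 2
    rw [norm_sub_sq_real, norm_smul, hm1, real_inner_smul_left, Real.norm_of_nonneg hs] at h2
    have h3 : 2 * (s * β) = ‖x - p‖ ^ 2 + 1 := by
      rw [hsdef]; field_simp
    change (s ^ 2 : ℝ) ≤ (s * 1) ^ 2 - 2 * (s * β) + ‖x - p‖ ^ 2 at h2
    linarith
  have hzero : ∀ m ∈ (tangentDirections S p)ᗮ, ∀ x ∈ S, inner ℝ m (x - p) = 0 := by
    intro m hm x hx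
    by_cases hm0 : m = 0
    · simp [hm0]
    have hpos : 0 < ‖m‖⁻¹ := inv_pos.2 (norm_pos_iff.2 hm0)
    have hn : ‖‖m‖⁻¹ • m‖ = 1 := by
      rw [norm_smul, norm_inv, norm_norm, inv_mul_cancel₀ (norm_ne_zero_iff.2 hm0)]
    have hm' := (tangentDirections S p)ᗮ.smul_mem ‖m‖⁻¹ hm
    have h1 := hin _ hm' hn x hx
    have h2 := hin _ ((tangentDirections S p)ᗮ.neg_mem hm') (by rw [norm_neg, hn]) x hx
    rw [inner_neg_left] at h2
    rw [real_inner_smul_left] at h1 h2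
    nlinarith
  refine Submodule.span_le.2 ?_
  rintro v ⟨γ, -, hγS, hγ⟩
  rw [SetLike.mem_coe, ← Submodule.orthogonal_orthogonal (tangentDirections S p)]
  intro m hm
  have h1 : HasDerivAt (fun t => inner ℝ m (γ t - p)) (inner ℝ m v) 0 := by
    simpa using (hasDerivAt_const (0 : ℝ) m).inner ℝ (hγ.sub_const p)
  have h2 : HasDerivAt (fun t => inner ℝ m (γ t - p)) 0 0 := by
    refine (hasDerivAt_const (0 : ℝ) (0 : ℝ)).congr_of_eventuallyEq ?_
    filter_upwards [hγS] with t ht using hzero m hm _ ht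
  exact h1.unique h2

end Assembly

/-! ### Transfer back to p, q and lfs(p), and the angle bounds. -/

section Final

variable {d k : ℕ} {S : Set (EuclideanSpace ℝ (Fin d))}

theorem infDist_tangentFlat (p q : EuclideanSpace ℝ (Fin d)) :
    Metric.infDist q (tangentFlat S p : Set (EuclideanSpace ℝ (Fin d))) =
      ‖q - p - (tangentDirections S p).starProjection (q - p)‖ := by
  set P := (tangentDirections S p).starProjection
  have hmem : p + P (q - p) ∈ (tangentFlat S p : Set (EuclideanSpace ℝ (Fin d))) := by
    rw [SetLike.mem_coe, tangentFlat, AffineSubspace.mem_mk', vsub_eq_sub, add_sub_cancel_left]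
    exact (tangentDirections S p).starProjection_apply_mem _
  apply le_antisymm
  · refine (Metric.infDist_le_dist_of_mem hmem).trans_eq ?_
    rw [dist_eq_norm, sub_sub]
  · refine (Metric.le_infDist ⟨_, hmem⟩).2 fun y hy => ?_
    rw [SetLike.mem_coe, tangentFlat, AffineSubspace.mem_mk', vsub_eq_sub] at hy
    have h1 : P (y - p) = y - p := Submodule.starProjection_eq_self_iff.2 hy
    have h2 : q - p - P (q - p) = (q - y) - P (q - y) := by
      rw [show q - y = (q - p) - (y - p) by abel, map_sub P (q - p) (y - p), h1]; abel
    rw [h2, dist_eq_norm]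
    have h3 := norm_sq_eq_starProjection_add_sub (tangentDirections S p) (q - y)
    exact le_of_sq_le_sq (by nlinarith [sq_nonneg ‖P (q - y)‖]) (norm_nonneg _)

theorem sq_lt_of_lt_sqrt_golden {δ : ℝ} (h0 : 0 ≤ δ) (h : δ < √((√5 - 1) / 2)) :
    δ ^ 2 < (√5 - 1) / 2 ∧ (0.381 : ℝ) ≤ 1 - δ ^ 2 := by
  have h1 : δ ^ 2 < (√5 - 1) / 2 := (Real.lt_sqrt h0).1 h
  have h2 : √5 ≤ 2.238 := Real.sqrt_le_iff.2 (by norm_num)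
  exact ⟨h1, by norm_num at h2 ⊢; linarith⟩

/-- The bounds on the angle between normal spaces, for points at relative distance `δ`. -/
theorem IsSmoothSubmanifold.relDist_bounds (hS : IsSmoothSubmanifold k S) (hc : IsCompact S)
    {p q : EuclideanSpace ℝ (Fin d)} (hp : p ∈ S) (hq : q ∈ S)
    (hlt : relDist S p q < ENNReal.ofReal √((√5 - 1) / 2)) :
    2 * (relNormalDist S p q).toReal ≤ (relDist S p q).toReal ^ 2 ∧
      ∀ m ∈ (tangentDirections S q)ᗮ, ‖m‖ = 1 →
        (1 - (relDist S p q).toReal ^ 2 / (2 * √(1 - (relDist S p q).toReal ^ 2))) ^ 2 -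
          (relNormalDist S p q).toReal ^ 2 / (1 - (relDist S p q).toReal ^ 2) ≤
          ‖(tangentDirections S p)ᗮ.starProjection m‖ ^ 2 := by
  -- The degenerate cases p = q and lfs(p) = ∞, where no rescaling is used.
  have hsame : tangentDirections S q = tangentDirections S p → (relDist S p q).toReal = 0 →
      (relNormalDist S p q).toReal = 0 →
      2 * (relNormalDist S p q).toReal ≤ (relDist S p q).toReal ^ 2 ∧
      ∀ m ∈ (tangentDirections S q)ᗮ, ‖m‖ = 1 →
        (1 - (relDist S p q).toReal ^ 2 / (2 * √(1 - (relDist S p q).toReal ^ 2))) ^ 2 -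
          (relNormalDist S p q).toReal ^ 2 / (1 - (relDist S p q).toReal ^ 2) ≤
          ‖(tangentDirections S p)ᗮ.starProjection m‖ ^ 2 := by
    intro hT h1 h2
    rw [h1, h2]
    refine ⟨by norm_num, fun m hm hm1 => ?_⟩
    rw [hT] at hm
    rw [Submodule.starProjection_eq_self_iff.2 hm, hm1]
    norm_num
  by_cases hpq : p = q
  · subst hpq
    refine hsame rfl (by simp [relDist]) ?_
    have : p ∈ (tangentFlat S p : Set (EuclideanSpace ℝ (Fin d))) :=
      AffineSubspace.self_mem_mk' p _
    simp [relNormalDist, Metric.infEDist_zero_of_mem this]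
  by_cases htop : localFeatureSize S p = ⊤
  · have hM : medialAxis S = ∅ := Metric.infEDist_eq_top_iff.1 htop
    exact hsame (le_antisymm (hS.tangentDirections_le hc hM hp) (hS.tangentDirections_le hc hM hq))
      (by simp [relDist, htop]) (by simp [relNormalDist, htop])
  have hzero : localFeatureSize S p ≠ 0 := by
    intro h0
    have : relDist S p q = ⊤ := by
      rw [relDist, h0, ENNReal.div_zero (edist_pos.2 hpq).ne']
    rw [this] at hlt
    exact not_top_lt hlt
  set R := (localFeatureSize S p).toReal with hR
  have hR0 : 0 < R := ENNReal.toReal_pos hzero htop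
  have hball : ∀ y ∈ Metric.ball p R, y ∉ medialAxis S := by
    intro y hy hyM
    have h1 : localFeatureSize S p ≤ edist p y := Metric.infEDist_le_edist_of_mem hyM
    have h2 : edist p y < ENNReal.ofReal R := by
      rw [edist_comm, edist_lt_ofReal]; exact hy
    rw [hR, ENNReal.ofReal_toReal htop] at h2
    exact absurd h1 (not_le.2 h2)
  have hN := hS.isNormalizedSurface hc hp hR0 hball
  set a := R⁻¹ • (q - p) with ha
  have hpa : p + R • a = q := by
    rw [ha, smul_smul, mul_inv_cancel₀ hR0.ne', one_smul, add_sub_cancel]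
  have hp0 : p + R • (0 : EuclideanSpace ℝ (Fin d)) = p := by simp
  have haS : a ∈ {a | p + R • a ∈ S} := by
    change p + R • a ∈ S
    rwa [hpa]
  have hδ : (relDist S p q).toReal = ‖a‖ := by
    rw [relDist, ENNReal.toReal_div, ← dist_edist, ha, norm_smul, norm_inv,
      Real.norm_of_nonneg hR0.le, dist_comm, dist_eq_norm, ← hR]
    field_simp
  have hδN : (relNormalDist S p q).toReal = ‖a - (tangentDirections S p).starProjection a‖ := by
    rw [relNormalDist, ENNReal.toReal_div, ← Metric.infDist, infDist_tangentFlat, ha, map_smul,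
      ← smul_sub, norm_smul, norm_inv, Real.norm_of_nonneg hR0.le, ← hR]
    field_simp
  have hδlt := ENNReal.toReal_lt_of_lt_ofReal hlt
  rw [hδ] at hδlt
  rw [hδ, hδN]
  refine ⟨?_, fun m hm hm1 => ?_⟩
  · have := hN.two_mul_norm_normal_le haS
    simpa only [hp0] using this
  · have := hN.normal_variation haS (sq_lt_of_lt_sqrt_golden (norm_nonneg _) hδlt).2
      (m := m) (by simpa only [hpa] using hm) hm1
    simp only [hp0] at this
    rwa [Submodule.starProjection_orthogonal_val]

theorem relNormalDist_eq_zero {p q : EuclideanSpace ℝ (Fin d)} (h : q ∈ tangentFlat S p) :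
    relNormalDist S p q = 0 := by
  rw [relNormalDist, Metric.infEDist_zero_of_mem h, ENNReal.zero_div]

theorem golden_bounds {δ : ℝ} (h0 : 0 ≤ δ) (h : δ < √((√5 - 1) / 2)) :
    0 < 1 - δ ^ 2 ∧ 0 ≤ 1 - δ ^ 2 / (2 * √(1 - δ ^ 2)) ∧ 1 - δ ^ 2 / (2 * √(1 - δ ^ 2)) ≤ 1 := by
  obtain ⟨-, h2⟩ := sq_lt_of_lt_sqrt_golden h0 h
  norm_num at h2
  have hpos : 0 < 1 - δ ^ 2 := by linarith
  have hσ := Real.sqrt_pos.2 hpos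
  have hσ2 := Real.sq_sqrt hpos.le
  refine ⟨hpos, ?_, ?_⟩
  · rw [sub_nonneg, div_le_one (by positivity)]
    have : 0.4 ≤ √(1 - δ ^ 2) := Real.le_sqrt_of_sq_le (by norm_num; linarith)
    norm_num at this
    nlinarith
  · have : 0 ≤ δ ^ 2 / (2 * √(1 - δ ^ 2)) := by positivity
    linarith

/-- Expanding the square gives the radicand of η₂ plus δ⁴ / (4(1 - δ²)), which absorbs the
subtracted δ_N term. -/
theorem etaNormal_le_eta₂ {δ δN : ℝ} (hpos : 0 < 1 - δ ^ 2) (h0 : 0 ≤ δN) (h : 2 * δN ≤ δ ^ 2) :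
    etaNormal δ δN ≤ eta₂ δ := by
  refine Real.arccos_le_arccos (Real.sqrt_le_sqrt ?_)
  have hσ := Real.sqrt_pos.2 hpos
  have hσ2 := Real.sq_sqrt hpos.le
  have h1 : (2 * δN) ^ 2 ≤ (δ ^ 2) ^ 2 := pow_le_pow_left₀ (by linarith) h 2
  have h2 : δN ^ 2 / (1 - δ ^ 2) ≤ (δ ^ 2) ^ 2 / (4 * (1 - δ ^ 2)) := by
    rw [div_le_div_iff₀ hpos (by linarith)]
    nlinarith
  have h3 : (1 - δ ^ 2 / (2 * √(1 - δ ^ 2))) ^ 2 =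
      1 - δ ^ 2 / √(1 - δ ^ 2) + (δ ^ 2) ^ 2 / (4 * (1 - δ ^ 2)) := by
    rw [show 4 * (1 - δ ^ 2) = 4 * √(1 - δ ^ 2) ^ 2 by rw [hσ2]]
    generalize √(1 - δ ^ 2) = σ at hσ
    field_simp
    ring
  linarith

theorem IsSmoothSubmanifold.flatAngle_tangentFlat (hS : IsSmoothSubmanifold k S)
    {p q : EuclideanSpace ℝ (Fin d)} (hp : p ∈ S) (hq : q ∈ S) :
    flatAngle (tangentFlat S p) (tangentFlat S q) =
      maxMinAngle (tangentFlat S p) (tangentFlat S q) := by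
  refine if_pos ?_
  rw [tangentFlat, tangentFlat, AffineSubspace.direction_mk', AffineSubspace.direction_mk',
    hS.finrank_tangentDirections hp, hS.finrank_tangentDirections hq]

theorem IsSmoothSubmanifold.finrank_normal (hS : IsSmoothSubmanifold k S)
    {p q : EuclideanSpace ℝ (Fin d)} (hp : p ∈ S) (hq : q ∈ S) :
    Module.finrank ℝ (tangentDirections S p)ᗮ = Module.finrank ℝ (tangentDirections S q)ᗮ := by
  have h1 := (tangentDirections S p).finrank_add_finrank_orthogonal
  have h2 := (tangentDirections S q).finrank_add_finrank_orthogonal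
  rw [hS.finrank_tangentDirections hp] at h1
  rw [hS.finrank_tangentDirections hq] at h2
  omega

theorem IsSmoothSubmanifold.flatAngle_normalFlat (hS : IsSmoothSubmanifold k S)
    {p q : EuclideanSpace ℝ (Fin d)} (hp : p ∈ S) (hq : q ∈ S) :
    flatAngle (normalFlat S p) (normalFlat S q) =
      maxMinAngle (normalFlat S p) (normalFlat S q) := by
  refine if_pos ?_
  rw [normalFlat, normalFlat, AffineSubspace.direction_mk', AffineSubspace.direction_mk',
    hS.finrank_normal hp hq]

theorem IsSmoothSubmanifold.flatAngle_normalFlat_eq (hS : IsSmoothSubmanifold k S)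
    {p q : EuclideanSpace ℝ (Fin d)} (hp : p ∈ S) (hq : q ∈ S) :
    flatAngle (normalFlat S p) (normalFlat S q) =
      flatAngle (tangentFlat S p) (tangentFlat S q) := by
  rw [hS.flatAngle_normalFlat hp hq, hS.flatAngle_tangentFlat hp hq]
  exact maxMinAngle_orthogonal p q
    ((hS.finrank_tangentDirections hp).trans (hS.finrank_tangentDirections hq).symm)

theorem IsSmoothSubmanifold.flatAngle_normalFlat_le (hS : IsSmoothSubmanifold k S)
    (hc : IsCompact S) {p q : EuclideanSpace ℝ (Fin d)} (hp : p ∈ S) (hq : q ∈ S)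
    (hlt : relDist S p q < ENNReal.ofReal √((√5 - 1) / 2)) :
    flatAngle (normalFlat S p) (normalFlat S q) ≤
      etaNormal (relDist S p q).toReal (relNormalDist S p q).toReal := by
  obtain ⟨-, hb⟩ := hS.relDist_bounds hc hp hq hlt
  obtain ⟨hpos, hf0, hf1⟩ := golden_bounds ENNReal.toReal_nonneg (ENNReal.toReal_lt_of_lt_ofReal hlt)
  rw [hS.flatAngle_normalFlat hp hq]
  unfold etaNormal
  set X := (1 - (relDist S p q).toReal ^ 2 / (2 * √(1 - (relDist S p q).toReal ^ 2))) ^ 2 -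
          (relNormalDist S p q).toReal ^ 2 / (1 - (relDist S p q).toReal ^ 2) with hX
  have hX1 : √X ≤ 1 := by
    rw [Real.sqrt_le_one]
    have h1 := pow_le_one₀ hf0 hf1 (n := 2)
    have h2 : 0 ≤ (relNormalDist S p q).toReal ^ 2 / (1 - (relDist S p q).toReal ^ 2) := by positivity
    linarith
  have hfr := hS.finrank_normal hp hq
  have hdir : ∀ p, (normalFlat S p).direction = (tangentDirections S p)ᗮ :=
    fun p => AffineSubspace.direction_mk' _ _
  rw [maxMinAngle_le_iff (by rw [hdir, hdir, hfr]) (Real.arccos_nonneg _)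
    (Real.arccos_le_pi_div_two.2 (Real.sqrt_nonneg _)),
    Real.cos_arccos (by linarith [Real.sqrt_nonneg X]) hX1]
  simp only [hdir]
  -- The estimate projects normals at q to the normal space at p, while the angle is taken in the
  -- other direction.
  refine mul_norm_le_norm_starProjection_symm hfr.symm fun m hm => ?_
  by_cases hm0 : m = 0
  · simp [hm0]
  have hmpos : 0 < ‖m‖ := norm_pos_iff.2 hm0
  have h1 := hb (‖m‖⁻¹ • m) ((tangentDirections S q)ᗮ.smul_mem _ hm) (by
    rw [norm_smul, norm_inv, norm_norm, inv_mul_cancel₀ hmpos.ne'])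
  have h3 := Real.sqrt_le_sqrt h1
  rw [Real.sqrt_sq (norm_nonneg _), map_smul, norm_smul, norm_inv, norm_norm, inv_mul_eq_div,
    le_div_iff₀ hmpos] at h3
  exact h3

end Final

theorem lemma6 {d k : ℕ} (hk : k < d) (S : Set (EuclideanSpace ℝ (Fin d)))
    (hS : IsSmoothSubmanifold k S) (hc : IsCompact S) :
    (∀ p ∈ S, ∀ q ∈ S,
      relDist S p q < ENNReal.ofReal √((√5 - 1) / 2) →
        flatAngle (normalFlat S p) (normalFlat S q) =
            flatAngle (tangentFlat S p) (tangentFlat S q) ∧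
        flatAngle (normalFlat S p) (normalFlat S q) ≤ eta₂ (relDist S p q).toReal ∧
        flatAngle (normalFlat S p) (normalFlat S q) ≤
            etaNormal (relDist S p q).toReal (relNormalDist S p q).toReal ∧
        etaNormal (relDist S p q).toReal (relNormalDist S p q).toReal ≤
            eta₂ (relDist S p q).toReal ∧
        (q ∈ tangentFlat S p →
          etaNormal (relDist S p q).toReal (relNormalDist S p q).toReal =
            eta₁ (relDist S p q).toReal)) ∧
    (fun δ : ℝ => eta₂ δ -
        (δ + 5 / 12 * δ ^ 3 + 57 / 160 * δ ^ 5 + 327 / 896 * δ ^ 7))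
      =O[nhdsWithin 0 (Set.Ioi 0)] (fun δ : ℝ => δ ^ 9) := by
  refine ⟨fun p hp q hq hlt => ?_, eta₂_expansion⟩
  obtain ⟨hN, -⟩ := hS.relDist_bounds hc hp hq hlt
  obtain ⟨hpos, hf0, -⟩ :=
    golden_bounds ENNReal.toReal_nonneg (ENNReal.toReal_lt_of_lt_ofReal hlt)
  have h1 := hS.flatAngle_normalFlat_le hc hp hq hlt
  have h2 := etaNormal_le_eta₂ hpos ENNReal.toReal_nonneg hN
  refine ⟨hS.flatAngle_normalFlat_eq hp hq, h1.trans h2, h1, h2, fun hqT => ?_⟩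
  rw [relNormalDist_eq_zero hqT, etaNormal, eta₁, ENNReal.toReal_zero, zero_pow two_ne_zero,
    zero_div, sub_zero, Real.sqrt_sq hf0]
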